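/- Let $\kappa\ge 0$ and consider in $\mathbb{R}^3\times(0,\infty)$ the system $$\partial_t u-\Delta u-\kappa\nabla\operatorname{div}u+u\cdot\nabla u+\tfrac{u}{2}\operatorname{div}u=0. \qquad (1.1)$$ Let $u_0\in L_{2,loc}(\mathbb{R}^3;\mathbb{R}^3)$. A vector field $u\in L_{2,loc}(\mathbb{R}^3\times[0,\infty);\mathbb{R}^3)$ with weak spatial gradient $\nabla u$ in $\mathbb{R}^3\times(0,\infty)$ is called a Leray solution of (1.1) with initial data $u_0$ if 1. for all $R>0$, $\displaystyle\sup_{x_0\in\mathbb{R}^3}\Big(\operatorname*{ess\,sup}_{0\le t<R^2}\int_{B(x_0,R)}|u(x,t)|^2\,dx+\int_0^{R^2}\!\!\int_{B(x_0,R)}|\nabla u|^2\,dx\,dt\Big)<\infty$; 2. (1.1) holds in $\mathcal{D}'(\mathbb{R}^3\times(0,\infty))$, and $\|u(\cdot,t)-u_0\|_{L_2(K)}\to0$ as $t\to0^+$ (disregarding null sets of times) for every compact $K\subset\mathbb{R}^3$; 3. for every smooth $\phi\ge0$ with compact support in $\mathbb{R}^3\times(0,\infty)$, $$\int_0^\infty\!\!\int_{\mathbb{R}^3}\big(|\nabla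 u|^2+\kappa(\operatorname{div}u)^2\big)\phi\,dx\,dt\le\int_0^\infty\!\!\int_{\mathbb{R}^3}\frac{|u|^2}{2}(\partial_t\phi+\Delta\phi)\,dx\,dt+\int_0^\infty\!\!\int_{\mathbb{R}^3}\Big(\frac{|u|^2}{2}-\kappa\operatorname{div}u\Big)u\cdot\nabla\phi\,dx\,dt.$$ **Lemma.** There are absolute constants $\mu>0$ and $C_0>0$ (in particular independent of $\kappa$, $u_0$, $R$, $u$) such that the following holds. Let $\kappa\ge0$, $R>0$, let $u_0\in L_{2,loc}(\mathbb{R}^3;\mathbb{R}^3)$ satisfy $$\alpha(R):=\sup_{x_0\in\mathbb{R}^3}\int_{B(x_0,R)}|u_0(x)|^2\,dx<\infty,$$ and let $u$ be a Leray solution of (1.1) with initial data $u_0$. Then for every $\lambda$ with $0<\lambda<\mu\min\{1,\alpha(R)^{-2}R^2,(1+\kappa)^{-1}\}$ (where $\alpha(R)^{-2}R^2=\infty$ if $\alpha(R)=0$), $$\sup_{x_0\in\mathbb{R}^3}\operatorname*{ess\,sup}_{0<t<\lambda R^2}\int_{B(x_0,R)}\frac{|u(x,t)|^2}{2}\,dx+\sup_{x_0\in\mathbb{R}^3}\int_0^{\lambda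 R^2}\!\!\int_{B(x_0,R)}\big(|\nabla u|^2+\kappa(\operatorname{div}u)^2\big)\,dx\,dt\le C_0\,\alpha(R).$$ -/

import Mathlib

open MeasureTheory Set Filter Topology
open scoped ENNReal ContDiff

noncomputable section

namespace ToyModel

/-- Euclidean three-space. -/
abbrev E3 : Type := EuclideanSpace ℝ (Fin 3)

/-- The open space-time domain `ℝ³ × (0, ∞)`; points are `z = (x, t)`. -/
def halfSpace : Set (E3 × ℝ) := univ ×ˢ Ioi 0

/-- Partial derivative in the `i`-th space variable of a scalar function on space-time. -/
def dx (i : Fin 3) (φ : E3 × ℝ → ℝ) (z : E3 × ℝ) : ℝ :=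
  fderiv ℝ φ z (EuclideanSpace.single i 1, 0)

/-- Partial derivative in time of a scalar function on space-time. -/
def dt (φ : E3 × ℝ → ℝ) (z : E3 × ℝ) : ℝ :=
  fderiv ℝ φ z (0, 1)

/-- Laplacian in the space variables. -/
def lap (φ : E3 × ℝ → ℝ) (z : E3 × ℝ) : ℝ :=
  ∑ i, dx i (dx i φ) z

/-- Smooth functions with compact support contained in `ℝ³ × (0, ∞)`. -/
structure IsTestFunction (φ : E3 × ℝ → ℝ) : Prop where
  smooth : ContDiff ℝ ∞ φ
  compact : HasCompactSupport φ
  supp : tsupport φ ⊆ halfSpace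

/-- `Du` is the weak (distributional) spatial gradient of `u` in `ℝ³ × (0, ∞)`;
`Du z i j` stands for `∂ u_i / ∂ x_j`. -/
structure HasWeakGradient (u : E3 × ℝ → E3) (Du : E3 × ℝ → Fin 3 → Fin 3 → ℝ) : Prop where
  locInt : ∀ i j, LocallyIntegrableOn (fun z => Du z i j) halfSpace volume
  byParts : ∀ i j, ∀ φ : E3 × ℝ → ℝ, IsTestFunction φ →
    ∫ z in halfSpace, u z i * dx j φ z = - ∫ z in halfSpace, Du z i j * φ z

/-- `|∇u|²` (the sum of the squares of all entries of the gradient). -/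
def gradSq (Du : E3 × ℝ → Fin 3 → Fin 3 → ℝ) (z : E3 × ℝ) : ℝ :=
  ∑ i, ∑ j, Du z i j ^ 2

/-- `div u`. -/
def dvg (Du : E3 × ℝ → Fin 3 → Fin 3 → ℝ) (z : E3 × ℝ) : ℝ :=
  ∑ j, Du z j j

/-- `∂ₜ u - Δ u - κ ∇ div u + u · ∇ u + (u / 2) div u = 0` in the sense of distributions
in `ℝ³ × (0, ∞)`, component by component. -/
def SolvesWeakly (κ : ℝ) (u : E3 × ℝ → E3) (Du : E3 × ℝ → Fin 3 → Fin 3 → ℝ) : Prop :=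
  ∀ i, ∀ φ : E3 × ℝ → ℝ, IsTestFunction φ →
    ∫ z in halfSpace,
      (- (u z i * dt φ z) - u z i * lap φ z - κ * ∑ j, u z j * dx j (dx i φ) z
        + (∑ j, u z j * Du z i j + u z i / 2 * dvg Du z) * φ z) = 0

/-- The local energy inequality. -/
def LocalEnergyInequality (κ : ℝ) (u : E3 × ℝ → E3)
    (Du : E3 × ℝ → Fin 3 → Fin 3 → ℝ) : Prop :=
  ∀ φ : E3 × ℝ → ℝ, IsTestFunction φ → (∀ z, 0 ≤ φ z) →
    ∫ z in halfSpace, (gradSq Du z + κ * dvg Du z ^ 2) * φ z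
      ≤ (∫ z in halfSpace, ‖u z‖ ^ 2 / 2 * (dt φ z + lap φ z))
        + ∫ z in halfSpace, (‖u z‖ ^ 2 / 2 - κ * dvg Du z) * ∑ j, u z j * dx j φ z

/-- `u`, with weak spatial gradient `Du`, is a Leray solution (local energy solution) of
`∂ₜ u - Δ u - κ ∇ div u + u · ∇ u + (u / 2) div u = 0` with initial data `u₀`.
As `u` is only determined almost everywhere, the limit `t → 0⁺` disregards null sets of times. -/
structure IsLeraySolution (κ : ℝ) (u₀ : E3 → E3) (u : E3 × ℝ → E3)
    (Du : E3 × ℝ → Fin 3 → Fin 3 → ℝ) : Prop where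
  locL2 : ∀ K : Set (E3 × ℝ), IsCompact K → K ⊆ univ ×ˢ Ici 0 → MemLp u 2 (volume.restrict K)
  weakGradient : HasWeakGradient u Du
  energyClass : ∀ R : ℝ, 0 < R →
    (⨆ x₀ : E3,
      (essSup (fun t => ∫⁻ x in Metric.ball x₀ R, ‖u (x, t)‖ₑ ^ 2)
          (volume.restrict (Ico (0 : ℝ) (R ^ 2)))
        + ∫⁻ t in Ioo (0 : ℝ) (R ^ 2), ∫⁻ x in Metric.ball x₀ R,
            ENNReal.ofReal (gradSq Du (x, t)))) < ⊤
  equation : SolvesWeakly κ u Du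
  initial : ∀ K : Set E3, IsCompact K →
    Tendsto (fun t : ℝ => eLpNorm (fun x => u (x, t) - u₀ x) 2 (volume.restrict K))
      (𝓝[>] 0 ⊓ ae volume) (𝓝 0)
  energyIneq : LocalEnergyInequality κ u Du

/-- `α(R) = sup_{x₀} ∫_{B(x₀,R)} |u₀|²`, as an extended nonnegative number. -/
def alpha (u₀ : E3 → E3) (R : ℝ) : ℝ≥0∞ :=
  ⨆ x₀ : E3, ∫⁻ x in Metric.ball x₀ R, ‖u₀ x‖ₑ ^ 2

end ToyModel

end

/-! This is the classical a priori estimate for local energy solutions in uniformly local spaces.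
The system has no pressure, so the local energy inequality is purely local. Test it with `χ(x)
θ(t)`, where `χ` is a cutoff equal to 1 on `B(q, R)` and supported in `B(q, 2R)`, and let `θ`
approach the indicator of an interval whose left end tends to 0. At almost every `t`, the energy of
`u` in `B(q, R)` plus the dissipation up to `t` is then bounded by the initial energy near `q` plus
the time integral of the flux terms containing `∇χ` and `Δχ` (`energy_distributional`,
`exists_ae_le_add_integral`, `exists_local_energy`).

On a time slice let `Y` and `Z` be the integrals over `B(q, 8R)` of `|u|²` and `|∇u|² + κ (div u)²`.
Interpolating `L³` between `L²` and `L⁶`, the local Sobolev inequality and Young's inequality bound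
the flux by `δ Z + c ((1 + κ) Y / R² + Y³ / R⁴)` (`exists_cubic_bound`, `exists_flux_bound`). The
term `κ div u (u · ∇χ)` is split so that half of `δ` pays for `κ (div u)²`; hence `κ` survives only
in the factor `1 + κ`.

A ball of radius `8R` is covered by `N` balls of radius `R`, with `N` absolute. Taking suprema over
centres with `δ = 1 / (2N)`, the dissipation on the right is half of the one on the left and is
absorbed, being finite by the energy class. The uniformly local energy `y` therefore satisfies `y(t)
≤ c (α + ∫₀ᵗ growth(y))`, and the same right-hand side bounds the dissipation
(`exists_uloc_inequality`).

A bootstrap closes the estimate (`gronwall_bootstrap`). While `y ≤ 4cα`, the integral up to time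
`λR²` is at most a constant times `(λ(1 + κ) + λα²/R²) α`, and the smallness of `λ` makes this at
most `α`.

Since `u` is only determined almost everywhere, time statements hold off null sets. Suprema over
centres are reduced to a dense sequence by lower semicontinuity, so that countably many null sets
suffice. -/

noncomputable section

namespace ToyModel

open scoped Convolution
open ContinuousLinearMap (lsmul)

/-! ### Cutoff functions, coverings and dense centres -/

/-- Partial derivative of a scalar function of the space variable. -/
def pd (j : Fin 3) (f : E3 → ℝ) (x : E3) : ℝ := fderiv ℝ f x (EuclideanSpace.single j 1)

lemma contDiff_pd {f : E3 → ℝ} (hf : ContDiff ℝ ∞ f) (j : Fin 3) : ContDiff ℝ ∞ (pd j f) :=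
  (hf.fderiv_right (m := ∞) (by simp)).clm_apply contDiff_const

lemma tsupport_pd_subset (f : E3 → ℝ) (j : Fin 3) : tsupport (pd j f) ⊆ tsupport f := by
  refine closure_minimal (fun x hx => ?_) (isClosed_tsupport f)
  by_contra h
  apply hx
  have : fderiv ℝ f x = 0 := by
    by_contra h'
    exact h (support_fderiv_subset ℝ h')
  simp [pd, this]

lemma hasCompactSupport_pd {f : E3 → ℝ} (hf : HasCompactSupport f) (j : Fin 3) :
    HasCompactSupport (pd j f) :=
  hf.mono' ((subset_tsupport _).trans (tsupport_pd_subset f j))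

/-- Uniformly scaled cutoff functions: `1` on `B(q, R)`, supported in `B(q, 2R)`. -/
lemma exists_cutoff : ∃ C : ℝ, 0 < C ∧ ∀ (q : E3) (R : ℝ), 0 < R → ∃ χ : E3 → ℝ,
    ContDiff ℝ ∞ χ ∧ HasCompactSupport χ ∧ (∀ x, 0 ≤ χ x) ∧ (∀ x, χ x ≤ 1) ∧
    (∀ x ∈ Metric.ball q R, χ x = 1) ∧ (∀ x ∉ Metric.ball q (2 * R), χ x = 0) ∧
    (∀ j x, |pd j χ x| ≤ C / R) ∧ (∀ x, |∑ j, pd j (pd j χ) x| ≤ C / R ^ 2) ∧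
    (∀ j, ∀ x ∉ Metric.ball q (2 * R), pd j χ x = 0) ∧
    (∀ x ∉ Metric.ball q (2 * R), ∑ j, pd j (pd j χ) x = 0) := by
  -- The outer radius is 3/2, not 2, so that the closed support, after rescaling, lies in the open
  -- ball `B(q, 2R)`; all derivatives then vanish outside that ball. One fixed bump serves every `q`
  -- and `R`, which makes the constant absolute.
  let f : ContDiffBump (0 : E3) := ⟨1, 3 / 2, by norm_num, by norm_num⟩
  have hf : ContDiff ℝ ∞ f := f.contDiff
  have hfc : HasCompactSupport f := f.hasCompactSupport
  have h1 : ∀ j, ∃ C, ∀ x, ‖pd j f x‖ ≤ C := fun j =>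
    (hasCompactSupport_pd hfc j).exists_bound_of_continuous (contDiff_pd hf j).continuous
  have h2 : ∀ j, ∃ C, ∀ x, ‖pd j (pd j f) x‖ ≤ C := fun j =>
    (hasCompactSupport_pd (hasCompactSupport_pd hfc j) j).exists_bound_of_continuous
      (contDiff_pd (contDiff_pd hf j) j).continuous
  choose C1 hC1 using h1
  choose C2 hC2 using h2
  have hC1' : ∀ j, 0 ≤ C1 j := fun j => (norm_nonneg _).trans (hC1 j 0)
  have hC2' : ∀ j, 0 ≤ C2 j := fun j => (norm_nonneg _).trans (hC2 j 0)
  refine ⟨1 + ∑ j, C1 j + ∑ j, C2 j, ?_, ?_⟩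
  · have := Finset.sum_nonneg (fun j (_ : j ∈ Finset.univ) => hC1' j)
    have := Finset.sum_nonneg (fun j (_ : j ∈ Finset.univ) => hC2' j)
    positivity
  intro q R hR
  let χ : E3 → ℝ := fun x => f (R⁻¹ • (x - q))
  have hscale : ∀ g : E3 → ℝ, ContDiff ℝ ∞ g → ∀ j x,
      pd j (fun x => g (R⁻¹ • (x - q))) x = R⁻¹ * pd j g (R⁻¹ • (x - q)) := by
    intro g hg j x
    have hd : HasFDerivAt (fun x : E3 => R⁻¹ • (x - q)) (R⁻¹ • ContinuousLinearMap.id ℝ E3) x :=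
      ((hasFDerivAt_id x).sub_const q).const_smul R⁻¹
    have hgd : HasFDerivAt g (fderiv ℝ g (R⁻¹ • (x - q))) (R⁻¹ • (x - q)) :=
      (hg.differentiable (by simp) _).hasFDerivAt
    have := (hgd.comp x hd).fderiv
    simp only [pd]
    change (fderiv ℝ (g ∘ fun x => R⁻¹ • (x - q)) x) _ = _
    rw [this]
    simp
  have hp : ∀ j, pd j χ = fun x => R⁻¹ * pd j f (R⁻¹ • (x - q)) := fun j =>
    funext fun x => hscale f hf j x
  have hpp : ∀ j x, pd j (pd j χ) x = (R ^ 2)⁻¹ * pd j (pd j f) (R⁻¹ • (x - q)) := by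
    intro j x
    have := hscale (fun y => R⁻¹ * pd j f y) (contDiff_const.mul (contDiff_pd hf j)) j x
    rw [hp j, this]
    have h3 : pd j (fun y => R⁻¹ * pd j f y) (R⁻¹ • (x - q))
        = R⁻¹ * pd j (pd j f) (R⁻¹ • (x - q)) := by
      unfold pd
      rw [fderiv_const_mul]
      · rfl
      · exact (contDiff_pd hf j).differentiable (by simp) _
    rw [h3]; field_simp
  have hball : ∀ x ∉ Metric.ball q (2 * R), R⁻¹ • (x - q) ∉ tsupport f := by
    intro x hx
    rw [f.tsupport_eq]
    simp only [Metric.mem_ball, not_lt, Metric.mem_closedBall, dist_zero_right, not_le] at hx ⊢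
    rw [norm_smul, Real.norm_of_nonneg (by positivity), ← dist_eq_norm]
    have : R⁻¹ * (2 * R) ≤ R⁻¹ * dist x q := by gcongr
    have h2 : R⁻¹ * (2 * R) = 2 := by field_simp
    change (3 / 2 : ℝ) < _
    linarith
  have hχc : ∀ x ∉ Metric.ball q (2 * R), χ x = 0 := fun x hx =>
    image_eq_zero_of_notMem_tsupport (f := f) (hball x hx)
  have hpc : ∀ j, ∀ x ∉ Metric.ball q (2 * R), pd j χ x = 0 := by
    intro j x hx
    rw [hp j]
    have := image_eq_zero_of_notMem_tsupport (fun h => hball x hx (tsupport_pd_subset f j h))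
    simp [this]
  have hs1 := Finset.sum_nonneg (fun j (_ : j ∈ Finset.univ) => hC1' j)
  have hs2 := Finset.sum_nonneg (fun j (_ : j ∈ Finset.univ) => hC2' j)
  refine ⟨χ, ?_, ?_, fun x => f.nonneg, fun x => f.le_one, ?_, hχc, ?_, ?_, hpc, ?_⟩
  · exact hf.comp ((contDiff_id.sub contDiff_const).const_smul R⁻¹)
  · exact HasCompactSupport.intro (isCompact_closedBall q (2 * R)) fun x hx =>
      hχc x fun h => hx (Metric.ball_subset_closedBall h)
  · intro x hx
    apply f.one_of_mem_closedBall
    rw [Metric.mem_ball] at hx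
    rw [Metric.mem_closedBall, dist_zero_right, norm_smul, Real.norm_of_nonneg (by positivity),
      ← dist_eq_norm]
    change _ ≤ (1 : ℝ)
    rw [inv_mul_le_iff₀ hR]; linarith
  · intro j x
    rw [hp j, abs_mul, abs_of_pos (inv_pos.2 hR), div_eq_inv_mul]
    gcongr
    have := Finset.single_le_sum (fun j _ => hC1' j) (Finset.mem_univ j)
    have h3 := hC1 j (R⁻¹ • (x - q))
    rw [Real.norm_eq_abs] at h3
    linarith
  · intro x
    simp_rw [hpp]
    rw [← Finset.mul_sum, abs_mul, abs_of_pos (by positivity), div_eq_inv_mul]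
    gcongr
    refine (Finset.abs_sum_le_sum_abs _ _).trans ?_
    have := Finset.sum_le_sum (fun j (_ : j ∈ Finset.univ) => hC2 j (R⁻¹ • (x - q)))
    simp only [Real.norm_eq_abs] at this
    linarith
  · intro x hx
    refine Finset.sum_eq_zero fun j _ => ?_
    rw [hpp]
    rw [image_eq_zero_of_notMem_tsupport (fun h =>
      hball x hx (tsupport_pd_subset f j (tsupport_pd_subset _ j h)))]
    simp

/-- A ball of radius `8R` is covered by a fixed number of balls of radius `R`. -/
lemma exists_covering : ∃ N : ℕ, 0 < N ∧ ∀ (R : ℝ), 0 < R → ∀ (f : E3 → ℝ≥0∞) (A : ℝ≥0∞),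
    (∀ x, ∫⁻ y in Metric.ball x R, f y ≤ A) →
    ∀ q, ∫⁻ y in Metric.ball q (8 * R), f y ≤ N * A := by
  obtain ⟨t, -, htf, ht⟩ := (isCompact_closedBall (0 : E3) 8).finite_cover_balls one_pos
  lift t to Finset E3 using htf
  -- The `+ 1` only secures `0 < N`. The cover of the ball of radius 8 by unit balls is transported
  -- by scaling and translation.
  refine ⟨t.card + 1, by omega, fun R hR f A h q => ?_⟩
  have hsub : Metric.ball q (8 * R) ⊆ ⋃ v ∈ t, Metric.ball (q + R • v) R := by
    intro x hx
    have : R⁻¹ • (x - q) ∈ Metric.closedBall (0 : E3) 8 := by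
      rw [Metric.mem_ball] at hx
      rw [Metric.mem_closedBall, dist_zero_right, norm_smul,
        Real.norm_of_nonneg (by positivity), ← dist_eq_norm, inv_mul_le_iff₀ hR]
      linarith
    obtain ⟨v, hv, hxv⟩ := mem_iUnion₂.1 (ht this)
    refine mem_iUnion₂.2 ⟨v, hv, ?_⟩
    rw [Metric.mem_ball, dist_eq_norm] at hxv ⊢
    have h2 : x - (q + R • v) = R • (R⁻¹ • (x - q) - v) := by
      rw [smul_sub, smul_smul, mul_inv_cancel₀ hR.ne', one_smul]; abel
    rw [h2, norm_smul, Real.norm_of_nonneg hR.le]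
    nlinarith
  calc ∫⁻ y in Metric.ball q (8 * R), f y
      ≤ ∫⁻ y in ⋃ v ∈ t, Metric.ball (q + R • v) R, f y := lintegral_mono_set hsub
    _ ≤ ∑ v ∈ t, ∫⁻ y in Metric.ball (q + R • v) R, f y := by
        refine (lintegral_mono' (Measure.restrict_biUnion_le t.countable_toSet) le_rfl).trans ?_
        rw [lintegral_sum_measure, tsum_fintype]
        exact (Finset.sum_coe_sort t fun v => ∫⁻ y in Metric.ball (q + R • v) R, f y).le
    _ ≤ ∑ v ∈ t, A := Finset.sum_le_sum fun v _ => h _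
    _ ≤ _ := by
        rw [Finset.sum_const, nsmul_eq_mul]; gcongr; simp

/-- Integrals over balls are lower semicontinuous in the centre. -/
lemma lintegral_ball_le_of_dense {ι : Type*} {p : ι → E3} (hp : DenseRange p) (R : ℝ)
    (f : E3 → ℝ≥0∞) (A : ℝ≥0∞) (h : ∀ i, ∫⁻ y in Metric.ball (p i) R, f y ≤ A) (x : E3) :
    ∫⁻ y in Metric.ball x R, f y ≤ A := by
  -- Each slightly smaller concentric ball lies in a ball of radius `R` around some point of the
  -- dense family; monotone convergence in the domain then needs no measurability of `f`.
  have hU : Metric.ball x R = ⋃ n : ℕ, Metric.ball x (R - 1 / ((n : ℝ) + 1)) := by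
    ext y
    simp only [Metric.mem_ball, mem_iUnion]
    constructor
    · intro hy
      obtain ⟨n, hn⟩ := exists_nat_one_div_lt (sub_pos.2 hy)
      exact ⟨n, by linarith⟩
    · rintro ⟨n, hn⟩
      have : 0 < 1 / ((n : ℝ) + 1) := by positivity
      linarith
  rw [hU, setLIntegral_iUnion_of_directed]
  · refine iSup_le fun n => ?_
    obtain ⟨i, hi⟩ := hp.exists_dist_lt x (ε := 1 / ((n : ℝ) + 1)) (by positivity)
    refine (lintegral_mono_set (Metric.ball_subset_ball' ?_)).trans (h i)
    linarith
  · refine Monotone.directed_le fun m n hmn => Metric.ball_subset_ball ?_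
    have : 1 / ((n : ℝ) + 1) ≤ 1 / ((m : ℝ) + 1) := by gcongr
    linarith

/-! ### Test functions of product form and Fubini on boxes -/

section products
variable {χ : E3 → ℝ} {θ : ℝ → ℝ}

lemma dx_mul (hχ : ContDiff ℝ ∞ χ) (hθ : ContDiff ℝ ∞ θ) (j : Fin 3) :
    dx j (fun z => χ z.1 * θ z.2) = fun z => pd j χ z.1 * θ z.2 := by
  funext z
  have h1 : HasFDerivAt (fun z : E3 × ℝ => χ z.1) _ z :=
    ((hχ.differentiable (by simp) z.1).hasFDerivAt).comp z hasFDerivAt_fst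
  have h2 : HasFDerivAt (fun z : E3 × ℝ => θ z.2) _ z :=
    ((hθ.differentiable (by simp) z.2).hasFDerivAt).comp z hasFDerivAt_snd
  simp only [dx, pd]
  rw [(h1.fun_mul h2).fderiv]
  simp [mul_comm]

lemma dt_mul (hχ : ContDiff ℝ ∞ χ) (hθ : ContDiff ℝ ∞ θ) :
    dt (fun z => χ z.1 * θ z.2) = fun z => χ z.1 * deriv θ z.2 := by
  funext z
  have h1 : HasFDerivAt (fun z : E3 × ℝ => χ z.1) _ z :=
    ((hχ.differentiable (by simp) z.1).hasFDerivAt).comp z hasFDerivAt_fst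
  have h2 : HasFDerivAt (fun z : E3 × ℝ => θ z.2) _ z :=
    ((hθ.differentiable (by simp) z.2).hasFDerivAt).comp z hasFDerivAt_snd
  simp only [dt]
  rw [(h1.fun_mul h2).fderiv]
  simp

lemma lap_mul (hχ : ContDiff ℝ ∞ χ) (hθ : ContDiff ℝ ∞ θ) :
    lap (fun z => χ z.1 * θ z.2) = fun z => (∑ j, pd j (pd j χ) z.1) * θ z.2 := by
  funext z
  simp only [lap, Finset.sum_mul]
  refine Finset.sum_congr rfl fun j _ => ?_
  rw [dx_mul hχ hθ, dx_mul (contDiff_pd hχ j) hθ]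

lemma isTestFunction_mul (hχ : ContDiff ℝ ∞ χ) (hχc : HasCompactSupport χ)
    (hθ : ContDiff ℝ ∞ θ) (hθc : HasCompactSupport θ) (hθs : tsupport θ ⊆ Ioi 0) :
    IsTestFunction (fun z => χ z.1 * θ z.2) := by
  have hsub : tsupport (fun z : E3 × ℝ => χ z.1 * θ z.2) ⊆ tsupport χ ×ˢ tsupport θ := by
    refine closure_minimal (fun z hz => ?_) ((isClosed_tsupport χ).prod (isClosed_tsupport θ))
    have := mul_ne_zero_iff.1 hz
    exact ⟨subset_tsupport _ this.1, subset_tsupport _ this.2⟩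
  refine ⟨(hχ.comp contDiff_fst).mul (hθ.comp contDiff_snd), ?_, ?_⟩
  · exact (hχc.isCompact.prod hθc.isCompact).of_isClosed_subset (isClosed_tsupport _) hsub
  · exact hsub.trans (prod_mono (subset_univ _) hθs)

lemma integrableOn_mul_of_bounded {f : E3 × ℝ → ℝ} {s : Set (E3 × ℝ)} (hf : IntegrableOn f s)
    {g : E3 × ℝ → ℝ} (hg : Continuous g) {C : ℝ} (hC : ∀ z, |g z| ≤ C) :
    IntegrableOn (fun z => f z * g z) s :=
  Integrable.mul_bdd hf hg.aestronglyMeasurable (Eventually.of_forall hC)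

lemma volume_restrict_prod (s : Set E3) (t : Set ℝ) :
    (volume : Measure (E3 × ℝ)).restrict (s ×ˢ t)
      = (volume.restrict s).prod (volume.restrict t) := by
  rw [Measure.prod_restrict]; rfl

lemma measurableSet_halfSpace : MeasurableSet halfSpace := MeasurableSet.univ.prod measurableSet_Ioi

/-- Fubini for a box with product weights. -/
lemma setIntegral_halfSpace_mul {f : E3 × ℝ → ℝ} {q : E3} {r T : ℝ}
    (hf : IntegrableOn f (Metric.ball q r ×ˢ Ioo 0 T))
    (hχ : Continuous χ) (hχc : HasCompactSupport χ) (hχ0 : ∀ x ∉ Metric.ball q r, χ x = 0)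
    (hθ : Continuous θ) (hθc : HasCompactSupport θ) (hθ0 : ∀ t ∉ Ioo 0 T, θ t = 0) :
    ∫ z in halfSpace, f z * (χ z.1 * θ z.2)
      = ∫ t in Ioo 0 T, (∫ x in Metric.ball q r, f (x, t) * χ x) * θ t := by
  obtain ⟨C, hC⟩ := hχc.exists_bound_of_continuous hχ
  obtain ⟨D, hD⟩ := hθc.exists_bound_of_continuous hθ
  have hint : IntegrableOn (fun z => f z * (χ z.1 * θ z.2)) (Metric.ball q r ×ˢ Ioo 0 T) := by
    refine integrableOn_mul_of_bounded hf (by fun_prop) (C := C * D) fun z => ?_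
    rw [abs_mul]
    have := hC z.1
    have := hD z.2
    simp only [Real.norm_eq_abs] at *
    gcongr
    exact (abs_nonneg _).trans (hC z.1)
  have hsub : Metric.ball q r ×ˢ Ioo 0 T ⊆ halfSpace :=
    prod_mono (subset_univ _) fun t ht => ht.1
  rw [setIntegral_eq_of_subset_of_forall_sdiff_eq_zero
    (s := Metric.ball q r ×ˢ Ioo 0 T) measurableSet_halfSpace hsub]
  · rw [IntegrableOn, volume_restrict_prod] at hint
    rw [volume_restrict_prod, integral_prod_symm _ hint]
    refine integral_congr_ae (Eventually.of_forall fun t => ?_)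
    simp only
    rw [← integral_mul_const]
    simp only [mul_assoc]
  · rintro ⟨x, t⟩ ⟨-, hz⟩
    rw [mem_prod, not_and_or] at hz
    rcases hz with hz | hz
    · simp [hχ0 x hz]
    · simp [hθ0 t hz]
end products

/-! ### Mollification -/

lemma lintegral_mul_sq_le {α : Type*} [MeasurableSpace α] (μ : Measure α) {f g : α → ℝ≥0∞}
    (hf : AEMeasurable f μ) (hg : AEMeasurable g μ) :
    (∫⁻ x, f x * g x ∂μ) ^ 2 ≤ (∫⁻ x, f x ^ 2 ∂μ) * ∫⁻ x, g x ^ 2 ∂μ := by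
  have h := ENNReal.lintegral_mul_le_Lp_mul_Lq μ Real.HolderConjugate.two_two hf hg
  calc (∫⁻ x, f x * g x ∂μ) ^ 2
      ≤ ((∫⁻ x, f x ^ (2 : ℝ) ∂μ) ^ (1 / (2 : ℝ)) * (∫⁻ x, g x ^ (2 : ℝ) ∂μ) ^ (1 / (2 : ℝ))) ^ 2 := by
        gcongr; exact h
    _ = _ := by
        rw [mul_pow, ← ENNReal.rpow_natCast, ← ENNReal.rpow_natCast, ← ENNReal.rpow_mul,
          ← ENNReal.rpow_mul]
        simp

/-- The Cauchy–Schwarz (Jensen) inequality for a weight of total mass one. -/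
lemma lintegral_weight_mul_sq_le {α : Type*} [MeasurableSpace α] (μ : Measure α)
    {a b : α → ℝ≥0∞} (ha : Measurable a) (ha1 : ∫⁻ x, a x ∂μ = 1) (hat : ∀ x, a x < ⊤)
    (hb : AEMeasurable b μ) :
    (∫⁻ x, a x * b x ∂μ) ^ 2 ≤ ∫⁻ x, a x * b x ^ 2 ∂μ := by
  have h := lintegral_mul_sq_le (μ.withDensity a) (f := fun _ => 1) (g := b) aemeasurable_const
    (hb.mono_ac (withDensity_absolutelyContinuous _ _))
  simp only [one_mul, one_pow, lintegral_const, withDensity_apply _ MeasurableSet.univ,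
    Measure.restrict_univ, ha1] at h
  rwa [lintegral_withDensity_eq_lintegral_mul_non_measurable _ ha (Eventually.of_forall hat),
    lintegral_withDensity_eq_lintegral_mul_non_measurable _ ha (Eventually.of_forall hat)] at h

/-- Bump functions shrinking to the origin. -/
def mollifier (E : Type*) [NormedAddCommGroup E] (n : ℕ) : ContDiffBump (0 : E) where
  rIn := 1 / (2 * ((n : ℝ) + 1))
  rOut := 1 / ((n : ℝ) + 1)
  rIn_pos := by positivity
  rIn_lt_rOut := by
    have : (0 : ℝ) < (n : ℝ) + 1 := by positivity
    rw [one_div_lt_one_div (by positivity) this]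
    linarith

lemma tendsto_rOut_mollifier (E : Type*) [NormedAddCommGroup E] :
    Tendsto (fun n => (mollifier E n).rOut) atTop (𝓝 0) :=
  tendsto_one_div_add_atTop_nhds_zero_nat

lemma ae_tendsto_mollifier {E : Type*} [NormedAddCommGroup E] [NormedSpace ℝ E]
    [FiniteDimensional ℝ E] [MeasureSpace E] [BorelSpace E]
    [(volume : Measure E).IsAddHaarMeasure] {g : E → ℝ} (hg : LocallyIntegrable g) :
    ∀ᵐ x, Tendsto (fun n => ((mollifier E n).normed volume ⋆[lsmul ℝ ℝ, volume] g) x) atTop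
      (𝓝 (g x)) := by
  refine ContDiffBump.ae_convolution_tendsto_right_of_locallyIntegrable (K := 2)
    (tendsto_rOut_mollifier E) (Eventually.of_forall fun n => ?_) hg
  change 1 / ((n : ℝ) + 1) ≤ 2 * (1 / (2 * ((n : ℝ) + 1)))
  apply le_of_eq; field_simp

lemma lintegral_normed_bump (f : ContDiffBump (0 : E3)) (x : E3) :
    ∫⁻ y, ‖f.normed volume (x - y)‖ₑ = 1 := by
  have h1 : ∫ y, f.normed volume (x - y) = 1 := by
    rw [integral_sub_left_eq_self (fun y => f.normed volume y)]
    exact f.integral_normed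
  have h2 : Integrable (fun y => f.normed volume (x - y)) :=
    (f.integrable_normed (μ := volume)).comp_sub_left x
  rw [← ofReal_integral_norm_eq_lintegral_enorm h2]
  simp only [Real.norm_of_nonneg (f.nonneg_normed _), h1, ENNReal.ofReal_one]

/-- Jensen for the probability density `ρ(x - ·)`, then Tonelli. The mollifier moves points by at
most `r`, so values on the smaller ball only see `g` on the larger one. -/
lemma lintegral_convolution_sq_le (f : ContDiffBump (0 : E3)) {q : E3} {r : ℝ} (hr : f.rOut ≤ r)
    {g : E3 → ℝ} (hg : LocallyIntegrable g) :
    ∫⁻ x in Metric.ball q (2 * r), ‖(f.normed volume ⋆[lsmul ℝ ℝ, volume] g) x‖ₑ ^ 2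
      ≤ ∫⁻ x in Metric.ball q (4 * r), ‖g x‖ₑ ^ 2 := by
  have hr0 : 0 < r := f.rOut_pos.trans_le hr
  have hgm : AEMeasurable (fun y => ‖g y‖ₑ) := hg.aestronglyMeasurable.enorm
  have hρ : Continuous (f.normed (volume : Measure E3)) := f.continuous_normed
  have hpt : ∀ x ∈ Metric.ball q (2 * r),
      ‖(f.normed volume ⋆[lsmul ℝ ℝ, volume] g) x‖ₑ ^ 2
        ≤ ∫⁻ y in Metric.ball q (4 * r), ‖f.normed volume (x - y)‖ₑ * ‖g y‖ₑ ^ 2 := by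
    intro x hx
    rw [convolution_lsmul_swap]
    calc ‖∫ y, f.normed volume (x - y) • g y‖ₑ ^ 2
        ≤ (∫⁻ y, ‖f.normed volume (x - y)‖ₑ * ‖g y‖ₑ) ^ 2 := by
          gcongr
          refine (enorm_integral_le_lintegral_enorm _).trans_eq ?_
          simp only [enorm_smul]
      _ ≤ ∫⁻ y, ‖f.normed volume (x - y)‖ₑ * ‖g y‖ₑ ^ 2 :=
          lintegral_weight_mul_sq_le _
            (hρ.comp (continuous_const.sub continuous_id)).enorm.measurable (lintegral_normed_bump f x)
            (fun _ => enorm_lt_top) hgm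
      _ = _ := by
          rw [setLIntegral_eq_of_support_subset]
          intro y hy
          have h1 : f.normed volume (x - y) ≠ 0 := by
            intro h; simp [h] at hy
          have h2 : x - y ∈ Metric.ball (0 : E3) f.rOut := by
            rw [← f.support_normed_eq (μ := volume)]; exact h1
          rw [Metric.mem_ball, dist_zero_right, ← dist_eq_norm] at h2
          rw [Metric.mem_ball] at hx ⊢
          have := dist_triangle y x q
          rw [dist_comm y x] at this
          linarith
  calc _ ≤ ∫⁻ x in Metric.ball q (2 * r), ∫⁻ y in Metric.ball q (4 * r),
          ‖f.normed volume (x - y)‖ₑ * ‖g y‖ₑ ^ 2 :=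
        setLIntegral_mono' Metric.isOpen_ball.measurableSet hpt
    _ ≤ ∫⁻ x, ∫⁻ y in Metric.ball q (4 * r), ‖f.normed volume (x - y)‖ₑ * ‖g y‖ₑ ^ 2 :=
        setLIntegral_le_lintegral _ _
    _ = ∫⁻ y in Metric.ball q (4 * r), ∫⁻ x, ‖f.normed volume (x - y)‖ₑ * ‖g y‖ₑ ^ 2 := by
        refine lintegral_lintegral_swap (AEMeasurable.mul (f := fun p : E3 × E3 =>
          ‖f.normed volume (p.1 - p.2)‖ₑ) (g := fun p : E3 × E3 => ‖g p.2‖ₑ ^ 2) ?_ ?_)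
        · exact (hρ.comp (continuous_fst.sub continuous_snd)).enorm.measurable.aemeasurable
        · exact ((hgm.pow_const 2).restrict).comp_snd
    _ = _ := by
        refine lintegral_congr fun y => ?_
        rw [lintegral_mul_const (f := fun x => ‖f.normed volume (x - y)‖ₑ) _
          (hρ.comp (continuous_sub_right y)).enorm.measurable]
        have : ∀ x, ‖f.normed volume (x - y)‖ₑ = ‖f.normed volume (y - x)‖ₑ := fun x => by
          rw [← f.normed_neg]; simp
        simp only [this, lintegral_normed_bump, one_mul]

/-! ### Weak gradients and the local Sobolev inequality -/

/-- `g` is the weak gradient of `v`, tested against the translates of the mollifiers. -/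
structure IsMollifiedGradient (v : E3 → ℝ) (g : Fin 3 → E3 → ℝ) : Prop where
  locInt : LocallyIntegrable v
  locInt_grad : ∀ j, LocallyIntegrable (g j)
  pd_eq : ∀ n j x, pd j ((mollifier E3 n).normed volume ⋆[lsmul ℝ ℝ, volume] v) x
    = ((mollifier E3 n).normed volume ⋆[lsmul ℝ ℝ, volume] (g j)) x

lemma norm_fderiv_le_sum_pd (w : E3 → ℝ) (x : E3) : ‖fderiv ℝ w x‖ ≤ ∑ j, |pd j w x| := by
  refine ContinuousLinearMap.opNorm_le_bound _ (by positivity) fun y => ?_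
  have hy : y = ∑ j, y j • EuclideanSpace.single j (1 : ℝ) := by
    ext i
    simp [Finset.sum_apply, Pi.single_apply]
  conv_lhs => rw [hy]
  rw [map_sum, Finset.sum_mul]
  refine (norm_sum_le _ _).trans (Finset.sum_le_sum fun j _ => ?_)
  rw [map_smul, norm_smul, mul_comm]
  exact mul_le_mul_of_nonneg_left (PiLp.norm_apply_le y j) (abs_nonneg _)

lemma enorm_fderiv_sq_le (w : E3 → ℝ) (x : E3) :
    ‖fderiv ℝ w x‖ₑ ^ 2 ≤ 3 * ∑ j, ‖pd j w x‖ₑ ^ 2 := by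
  have h : ‖fderiv ℝ w x‖ ^ 2 ≤ 3 * ∑ j, ‖pd j w x‖ ^ 2 := by
    have h1 := norm_fderiv_le_sum_pd w x
    have h2 : (∑ j, |pd j w x|) ^ 2 ≤ 3 * ∑ j, |pd j w x| ^ 2 := by
      simpa using sq_sum_le_card_mul_sum_sq (s := Finset.univ) (f := fun j => |pd j w x|)
    simp only [Real.norm_eq_abs]
    refine le_trans ?_ h2
    gcongr
  have h3 := ENNReal.ofReal_le_ofReal h
  rw [ENNReal.ofReal_mul (by norm_num), ENNReal.ofReal_sum_of_nonneg (fun _ _ => by positivity)] at h3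
  simpa only [ENNReal.ofReal_pow (norm_nonneg _), ofReal_norm, ENNReal.ofReal_ofNat] using h3

/-- The Gagliardo–Nirenberg–Sobolev inequality in dimension 3 with exponents 2 and 6, raised to the
sixth power to remove the roots. The 27 is the cube of the 3 in `enorm_fderiv_sq_le`. -/
lemma exists_sobolev_const : ∃ K : NNReal, ∀ w : E3 → ℝ, ContDiff ℝ 1 w → HasCompactSupport w →
    ∫⁻ x, ‖w x‖ₑ ^ 6 ≤ K * (∑ j, ∫⁻ x, ‖pd j w x‖ₑ ^ 2) ^ 3 := by
  refine ⟨(eLpNormLESNormFDerivOfEqInnerConst (volume : Measure E3) 2) ^ 6 * 27, fun w hw hwc => ?_⟩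
  have h := eLpNorm_le_eLpNorm_fderiv_of_eq_inner (μ := (volume : Measure E3)) (p := 2) (p' := 6)
    hw hwc (by norm_num) (by simp) (by simp; norm_num)
  have e6 : eLpNorm w ((6 : NNReal) : ℝ≥0∞) volume ^ 6 = ∫⁻ x, ‖w x‖ₑ ^ 6 := by
    rw [eLpNorm_nnreal_eq_lintegral (by norm_num), ← ENNReal.rpow_natCast, ← ENNReal.rpow_mul]
    simp
  have e2 : eLpNorm (fderiv ℝ w) ((2 : NNReal) : ℝ≥0∞) volume ^ 2 = ∫⁻ x, ‖fderiv ℝ w x‖ₑ ^ 2 := by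
    rw [eLpNorm_nnreal_eq_lintegral (by norm_num), ← ENNReal.rpow_natCast, ← ENNReal.rpow_mul]
    simp
  have hm : ∀ j, Measurable fun x => ‖pd j w x‖ₑ ^ 2 := fun j =>
    (((hw.continuous_fderiv (by simp)).clm_apply continuous_const).enorm.measurable).pow_const 2
  rw [← e6]
  calc eLpNorm w ((6 : NNReal) : ℝ≥0∞) volume ^ 6
      ≤ (eLpNormLESNormFDerivOfEqInnerConst (volume : Measure E3) 2 *
          eLpNorm (fderiv ℝ w) ((2 : NNReal) : ℝ≥0∞) volume) ^ 6 := by gcongr; exact h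
    _ = (eLpNormLESNormFDerivOfEqInnerConst (volume : Measure E3) 2 : ℝ≥0∞) ^ 6 *
          (∫⁻ x, ‖fderiv ℝ w x‖ₑ ^ 2) ^ 3 := by
        rw [← e2, mul_pow]; ring
    _ ≤ (eLpNormLESNormFDerivOfEqInnerConst (volume : Measure E3) 2 : ℝ≥0∞) ^ 6 *
          (3 * ∑ j, ∫⁻ x, ‖pd j w x‖ₑ ^ 2) ^ 3 := by
        gcongr
        rw [← lintegral_finsetSum _ fun j _ => hm j, ← lintegral_const_mul]
        · exact lintegral_mono fun x => enorm_fderiv_sq_le w x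
        · exact Finset.measurable_sum _ fun j _ => hm j
    _ = _ := by push_cast; ring

lemma enorm_add_sq_le (a b : ℝ) : ‖a + b‖ₑ ^ 2 ≤ 2 * (‖a‖ₑ ^ 2 + ‖b‖ₑ ^ 2) := by
  have h : (‖a + b‖ : ℝ) ^ 2 ≤ 2 * (‖a‖ ^ 2 + ‖b‖ ^ 2) := by
    simp only [Real.norm_eq_abs, sq_abs]
    nlinarith [sq_nonneg (a - b)]
  have h3 := ENNReal.ofReal_le_ofReal h
  rw [ENNReal.ofReal_mul (by norm_num), ENNReal.ofReal_add (by positivity) (by positivity)] at h3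
  simpa only [ENNReal.ofReal_pow (norm_nonneg _), ofReal_norm, ENNReal.ofReal_ofNat] using h3

/-- The local Sobolev inequality `L⁶ ⊂ H¹` on concentric balls. -/
lemma exists_local_sobolev : ∃ K : NNReal, ∀ (q : E3) (r : ℝ), 0 < r →
    ∀ (v : E3 → ℝ) (g : Fin 3 → E3 → ℝ), IsMollifiedGradient v g →
    ∫⁻ x in Metric.ball q r, ‖v x‖ₑ ^ 6
      ≤ K * ((∑ j, ∫⁻ x in Metric.ball q (4 * r), ‖g j x‖ₑ ^ 2)
          + ENNReal.ofReal (1 / r ^ 2) * ∫⁻ x in Metric.ball q (4 * r), ‖v x‖ₑ ^ 2) ^ 3 := by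
  obtain ⟨K, hK⟩ := exists_sobolev_const
  obtain ⟨C, hC, hcut⟩ := exists_cutoff
  refine ⟨K * (2 * (1 + 3 * (C ^ 2).toNNReal)) ^ 3, fun q r hr v g hv => ?_⟩
  obtain ⟨χ, hχ, hχc, hχ0, hχ1, hχB, hχB', hχp, -, hχpB, -⟩ := hcut q r hr
  set G : ℝ≥0∞ := ∑ j, ∫⁻ x in Metric.ball q (4 * r), ‖g j x‖ₑ ^ 2 with hG
  set V : ℝ≥0∞ := ∫⁻ x in Metric.ball q (4 * r), ‖v x‖ₑ ^ 2 with hV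
  -- The Sobolev inequality is available for `C¹` functions of compact support, hence is applied to
  -- `χ vₙ` with `vₙ` mollified. The gradient of `vₙ` is the mollified `g`, so the bounds are
  -- uniform in `n` once the mollification radius is at most `r`.
  let vn : ℕ → E3 → ℝ := fun n => (mollifier E3 n).normed volume ⋆[lsmul ℝ ℝ, volume] v
  have hvn : ∀ n, ContDiff ℝ 1 (vn n) := fun n =>
    (mollifier E3 n).hasCompactSupport_normed.contDiff_convolution_left _
      ((mollifier E3 n).contDiff_normed (n := 1)) hv.locInt
  have hgn : ∀ n j, Continuous ((mollifier E3 n).normed volume ⋆[lsmul ℝ ℝ, volume] (g j)) :=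
    fun n j => (mollifier E3 n).hasCompactSupport_normed.continuous_convolution_left _
      (mollifier E3 n).continuous_normed (hv.locInt_grad j)
  have hbound : ∀ n, (mollifier E3 n).rOut ≤ r →
      ∫⁻ x in Metric.ball q r, ‖vn n x‖ₑ ^ 6
        ≤ K * (2 * (G + 3 * (ENNReal.ofReal (C ^ 2) * (ENNReal.ofReal (1 / r ^ 2) * V)))) ^ 3 := by
    intro n hn
    let w : E3 → ℝ := fun x => χ x * vn n x
    have hw : ContDiff ℝ 1 w := (hχ.of_le (by simp)).mul (hvn n)
    have hpd : ∀ j x, pd j w x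
        = χ x * ((mollifier E3 n).normed volume ⋆[lsmul ℝ ℝ, volume] (g j)) x
          + pd j χ x * vn n x := by
      intro j x
      rw [← hv.pd_eq n j x]
      have h1 := (hχ.differentiable (by simp) x).hasFDerivAt
      have h2 := ((hvn n).differentiable (by simp) x).hasFDerivAt
      simp only [pd]
      rw [(h1.fun_mul h2).fderiv]
      simp [vn, mul_comm]
    have hb : ∀ j, ∫⁻ x, ‖pd j w x‖ₑ ^ 2
        ≤ 2 * ((∫⁻ x in Metric.ball q (4 * r), ‖g j x‖ₑ ^ 2)
          + ENNReal.ofReal (C ^ 2) * (ENNReal.ofReal (1 / r ^ 2) * V)) := by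
      intro j
      calc ∫⁻ x, ‖pd j w x‖ₑ ^ 2
          = ∫⁻ x in Metric.ball q (2 * r), ‖pd j w x‖ₑ ^ 2 := by
            rw [setLIntegral_eq_of_support_subset]
            intro x hx
            by_contra hxB
            apply hx
            simp [hpd, hχB' x hxB, hχpB j x hxB]
        _ ≤ ∫⁻ x in Metric.ball q (2 * r),
              2 * (‖((mollifier E3 n).normed volume ⋆[lsmul ℝ ℝ, volume] (g j)) x‖ₑ ^ 2
                + ENNReal.ofReal (C ^ 2) * ENNReal.ofReal (1 / r ^ 2) * ‖vn n x‖ₑ ^ 2) := by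
            refine lintegral_mono fun x => ?_
            simp only
            rw [hpd]
            refine (enorm_add_sq_le _ _).trans ?_
            gcongr 2 * (?_ + ?_)
            · rw [enorm_mul]
              have : ‖χ x‖ₑ ≤ 1 := by
                rw [Real.enorm_of_nonneg (hχ0 x)]
                exact ENNReal.ofReal_le_one.2 (hχ1 x)
              gcongr
              exact mul_le_of_le_one_left (by simp) this
            · rw [enorm_mul, mul_pow, ← ENNReal.ofReal_mul (by positivity)]
              gcongr
              rw [← ofReal_norm, ← ENNReal.ofReal_pow (norm_nonneg _), Real.norm_eq_abs]
              apply ENNReal.ofReal_le_ofReal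
              calc |pd j χ x| ^ 2 ≤ (C / r) ^ 2 := by gcongr; exact hχp j x
                _ = _ := by ring
        _ = 2 * ((∫⁻ x in Metric.ball q (2 * r),
              ‖((mollifier E3 n).normed volume ⋆[lsmul ℝ ℝ, volume] (g j)) x‖ₑ ^ 2)
                + ENNReal.ofReal (C ^ 2) * (ENNReal.ofReal (1 / r ^ 2) *
                  ∫⁻ x in Metric.ball q (2 * r), ‖vn n x‖ₑ ^ 2)) := by
            have m1 : Measurable fun x =>
                ‖((mollifier E3 n).normed volume ⋆[lsmul ℝ ℝ, volume] (g j)) x‖ₑ ^ 2 :=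
              (hgn n j).enorm.measurable.pow_const 2
            have m2 : Measurable fun x => ‖vn n x‖ₑ ^ 2 :=
              (hvn n).continuous.enorm.measurable.pow_const 2
            rw [lintegral_const_mul _ (by fun_prop), lintegral_add_left m1,
              lintegral_const_mul _ m2, mul_assoc]
        _ ≤ _ := by
            exact mul_le_mul' le_rfl (add_le_add
              (lintegral_convolution_sq_le _ hn (hv.locInt_grad j)) (mul_le_mul' le_rfl
                (mul_le_mul' le_rfl (lintegral_convolution_sq_le _ hn hv.locInt))))
    calc ∫⁻ x in Metric.ball q r, ‖vn n x‖ₑ ^ 6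
        = ∫⁻ x in Metric.ball q r, ‖w x‖ₑ ^ 6 := by
          refine setLIntegral_congr_fun Metric.isOpen_ball.measurableSet fun x hx => ?_
          simp [w, hχB x hx]
      _ ≤ ∫⁻ x, ‖w x‖ₑ ^ 6 := setLIntegral_le_lintegral _ _
      _ ≤ K * (∑ j, ∫⁻ x, ‖pd j w x‖ₑ ^ 2) ^ 3 := hK w hw hχc.mul_right
      _ ≤ K * (∑ j, 2 * ((∫⁻ x in Metric.ball q (4 * r), ‖g j x‖ₑ ^ 2)
          + ENNReal.ofReal (C ^ 2) * (ENNReal.ofReal (1 / r ^ 2) * V))) ^ 3 := by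
          gcongr with j; exact hb j
      _ = _ := by
          rw [← Finset.mul_sum, Finset.sum_add_distrib]; simp [hG]
  -- Fatou's lemma along the almost everywhere convergence `vₙ → v`.
  calc ∫⁻ x in Metric.ball q r, ‖v x‖ₑ ^ 6
      = ∫⁻ x in Metric.ball q r, liminf (fun n => ‖vn n x‖ₑ ^ 6) atTop := by
        refine lintegral_congr_ae (ae_restrict_of_ae ?_)
        filter_upwards [ae_tendsto_mollifier hv.locInt] with x hx
        exact ((ENNReal.continuous_pow 6).continuousAt.tendsto.comp hx.enorm).liminf_eq.symm
    _ ≤ liminf (fun n => ∫⁻ x in Metric.ball q r, ‖vn n x‖ₑ ^ 6) atTop :=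
        lintegral_liminf_le fun n => (hvn n).continuous.enorm.measurable.pow_const 6
    _ ≤ K * (2 * (G + 3 * (ENNReal.ofReal (C ^ 2) * (ENNReal.ofReal (1 / r ^ 2) * V)))) ^ 3 := by
        have hev : ∀ᶠ n in atTop, (mollifier E3 n).rOut ≤ r :=
          ((tendsto_rOut_mollifier E3).eventually (gt_mem_nhds hr)).mono fun n hn => hn.le
        refine liminf_le_of_frequently_le' (Eventually.frequently ?_)
        exact hev.mono hbound
    _ ≤ K * (2 * ((1 + 3 * ENNReal.ofReal (C ^ 2)) * (G + ENNReal.ofReal (1 / r ^ 2) * V))) ^ 3 := by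
        gcongr _ * (_ * ?_) ^ 3
        calc G + 3 * (ENNReal.ofReal (C ^ 2) * (ENNReal.ofReal (1 / r ^ 2) * V))
            ≤ G + 3 * (ENNReal.ofReal (C ^ 2) * (ENNReal.ofReal (1 / r ^ 2) * V))
              + (ENNReal.ofReal (1 / r ^ 2) * V + 3 * ENNReal.ofReal (C ^ 2) * G) := le_self_add
          _ = _ := by ring
    _ = _ := by
        push_cast
        rw [ENNReal.ofReal]
        ring

/-! ### Integrability of a Leray solution on boxes -/

lemma gradSq_nonneg (Du : E3 × ℝ → Fin 3 → Fin 3 → ℝ) (z : E3 × ℝ) : 0 ≤ gradSq Du z :=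
  Finset.sum_nonneg fun _ _ => Finset.sum_nonneg fun _ _ => sq_nonneg _

lemma sq_le_gradSq (Du : E3 × ℝ → Fin 3 → Fin 3 → ℝ) (z : E3 × ℝ) (i j : Fin 3) :
    Du z i j ^ 2 ≤ gradSq Du z :=
  (Finset.single_le_sum (f := fun j => Du z i j ^ 2) (fun _ _ => sq_nonneg _)
    (Finset.mem_univ j)).trans (Finset.single_le_sum (f := fun i => ∑ j, Du z i j ^ 2)
      (fun _ _ => Finset.sum_nonneg fun _ _ => sq_nonneg _) (Finset.mem_univ i))

lemma dvg_sq_le (Du : E3 × ℝ → Fin 3 → Fin 3 → ℝ) (z : E3 × ℝ) :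
    dvg Du z ^ 2 ≤ 3 * gradSq Du z := by
  have h2 : (∑ j, Du z j j) ^ 2 ≤ 3 * ∑ j, Du z j j ^ 2 := by
    simpa using sq_sum_le_card_mul_sum_sq (s := Finset.univ) (f := fun j => Du z j j)
  refine h2.trans ?_
  gcongr
  exact Finset.sum_le_sum fun i _ => Finset.single_le_sum (f := fun j => Du z i j ^ 2)
    (fun _ _ => sq_nonneg _) (Finset.mem_univ i)

variable {κ : ℝ} {u₀ : E3 → E3} {u : E3 × ℝ → E3} {Du : E3 × ℝ → Fin 3 → Fin 3 → ℝ}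

lemma volume_box_lt_top (q : E3) (r T : ℝ) :
    (volume : Measure (E3 × ℝ)) (Metric.ball q r ×ˢ Ioo 0 T) < ⊤ := by
  refine (measure_mono (Set.prod_mono Metric.ball_subset_closedBall Ioo_subset_Icc_self)).trans_lt
    ((isCompact_closedBall q r).prod isCompact_Icc).measure_lt_top

lemma IsLeraySolution.memLp_box (h : IsLeraySolution κ u₀ u Du) (q : E3) (r T : ℝ) :
    MemLp u 2 (volume.restrict (Metric.ball q r ×ˢ Ioo 0 T)) :=
  (h.locL2 (Metric.closedBall q r ×ˢ Icc 0 T) ((isCompact_closedBall q r).prod isCompact_Icc)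
    (prod_mono (subset_univ _) fun _ ht => ht.1)).mono_measure
      (Measure.restrict_mono (Set.prod_mono Metric.ball_subset_closedBall Ioo_subset_Icc_self) le_rfl)

lemma IsLeraySolution.integrableOn_sq (h : IsLeraySolution κ u₀ u Du) (q : E3) (r T : ℝ) :
    IntegrableOn (fun z => ‖u z‖ ^ 2) (Metric.ball q r ×ˢ Ioo 0 T) :=
  (h.memLp_box q r T).integrable_norm_pow (by norm_num)

lemma IsLeraySolution.integrableOn (h : IsLeraySolution κ u₀ u Du) (q : E3) (r T : ℝ)
    (i : Fin 3) : IntegrableOn (fun z => u z i) (Metric.ball q r ×ˢ Ioo 0 T) := by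
  have : IsFiniteMeasure (volume.restrict (Metric.ball q r ×ˢ Ioo 0 T) : Measure (E3 × ℝ)) :=
    ⟨by rw [Measure.restrict_apply_univ]; exact volume_box_lt_top q r T⟩
  have h1 : Integrable u (volume.restrict (Metric.ball q r ×ˢ Ioo 0 T)) :=
    (h.memLp_box q r T).integrable (by norm_num)
  exact (EuclideanSpace.proj i : E3 →L[ℝ] ℝ).integrable_comp h1

lemma IsLeraySolution.aestronglyMeasurable_grad (h : IsLeraySolution κ u₀ u Du) (q : E3)
    (r T : ℝ) (i j : Fin 3) :
    AEStronglyMeasurable (fun z => Du z i j) (volume.restrict (Metric.ball q r ×ˢ Ioo 0 T)) :=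
  ((h.weakGradient.locInt i j).aestronglyMeasurable).mono_measure
    (Measure.restrict_mono (prod_mono (subset_univ _) fun _ ht => ht.1) le_rfl)

lemma IsLeraySolution.aestronglyMeasurable_gradSq (h : IsLeraySolution κ u₀ u Du) (q : E3)
    (r T : ℝ) :
    AEStronglyMeasurable (gradSq Du) (volume.restrict (Metric.ball q r ×ˢ Ioo 0 T)) := by
  unfold gradSq
  refine Finset.aestronglyMeasurable_fun_sum _ fun i _ =>
    Finset.aestronglyMeasurable_fun_sum _ fun j _ => ?_
  exact (h.aestronglyMeasurable_grad q r T i j).pow 2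

lemma IsLeraySolution.aestronglyMeasurable_dvg (h : IsLeraySolution κ u₀ u Du) (q : E3)
    (r T : ℝ) :
    AEStronglyMeasurable (dvg Du) (volume.restrict (Metric.ball q r ×ˢ Ioo 0 T)) := by
  unfold dvg
  exact Finset.aestronglyMeasurable_fun_sum _ fun j _ => h.aestronglyMeasurable_grad q r T j j

lemma lintegral_box {f : E3 × ℝ → ℝ≥0∞} {s : Set E3} {t : Set ℝ}
    (hf : AEMeasurable f (volume.restrict (s ×ˢ t))) :
    ∫⁻ z in s ×ˢ t, f z = ∫⁻ τ in t, ∫⁻ x in s, f (x, τ) := by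
  rw [volume_restrict_prod] at hf ⊢
  exact lintegral_prod_symm f hf

lemma IsLeraySolution.integrableOn_gradSq (h : IsLeraySolution κ u₀ u Du) (q : E3) (r T : ℝ) :
    IntegrableOn (gradSq Du) (Metric.ball q r ×ˢ Ioo 0 T) := by
  refine ⟨h.aestronglyMeasurable_gradSq q r T, ?_⟩
  have hm := (h.aestronglyMeasurable_gradSq q r T).enorm
  rw [HasFiniteIntegral, lintegral_box hm]
  -- The energy class controls the cylinders `B(q, ρ) × (0, ρ²)`; this `ρ` satisfies both `r ≤ ρ`
  -- and `T ≤ ρ²`.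
  set ρ : ℝ := |r| + |T| + 1
  have hρ : 0 < ρ := by positivity
  have hρr : r ≤ ρ := by
    have := le_abs_self r; have := abs_nonneg T; simp only [ρ]; linarith
  have hρT : T ≤ ρ ^ 2 := by
    have := le_abs_self T; have := abs_nonneg r; have := abs_nonneg T
    simp only [ρ]; nlinarith
  have hE := h.energyClass ρ hρ
  refine lt_of_le_of_lt ?_ hE
  refine le_trans ?_ (le_iSup _ q)
  refine le_trans ?_ le_add_self
  refine (lintegral_mono' (Measure.restrict_mono (Ioo_subset_Ioo_right hρT) le_rfl) fun t => ?_)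
  refine (lintegral_mono' (Measure.restrict_mono (Metric.ball_subset_ball hρr) le_rfl) fun x => ?_)
  rw [Real.enorm_of_nonneg (gradSq_nonneg _ _)]

lemma IsLeraySolution.integrableOn_grad (h : IsLeraySolution κ u₀ u Du) (q : E3) (r T : ℝ)
    (i j : Fin 3) : IntegrableOn (fun z => Du z i j) (Metric.ball q r ×ˢ Ioo 0 T) := by
  have hc : IntegrableOn (fun _ : E3 × ℝ => (1 : ℝ)) (Metric.ball q r ×ˢ Ioo 0 T) :=
    integrableOn_const (volume_box_lt_top q r T).ne
  refine Integrable.mono' (hc.add (h.integrableOn_gradSq q r T))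
    (h.aestronglyMeasurable_grad q r T i j) (Eventually.of_forall fun z => ?_)
  have := sq_le_gradSq Du z i j
  simp only [Real.norm_eq_abs, Pi.add_apply]
  nlinarith [sq_abs (Du z i j), sq_nonneg (|Du z i j| - 1)]

/-- The dissipation density `|∇u|² + κ (div u)²`. -/
def dissip (κ : ℝ) (Du : E3 × ℝ → Fin 3 → Fin 3 → ℝ) (z : E3 × ℝ) : ℝ :=
  gradSq Du z + κ * dvg Du z ^ 2

lemma dissip_nonneg (hκ : 0 ≤ κ) (z : E3 × ℝ) : 0 ≤ dissip κ Du z :=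
  add_nonneg (gradSq_nonneg _ _) (by positivity)

lemma dissip_le (hκ : 0 ≤ κ) (z : E3 × ℝ) : dissip κ Du z ≤ (1 + 3 * κ) * gradSq Du z := by
  have := mul_le_mul_of_nonneg_left (dvg_sq_le Du z) hκ
  simp only [dissip]; linarith

lemma IsLeraySolution.integrableOn_dissip (h : IsLeraySolution κ u₀ u Du) (hκ : 0 ≤ κ) (q : E3)
    (r T : ℝ) : IntegrableOn (dissip κ Du) (Metric.ball q r ×ˢ Ioo 0 T) := by
  refine Integrable.mono' ((h.integrableOn_gradSq q r T).const_mul (1 + 3 * κ))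
    ((h.aestronglyMeasurable_gradSq q r T).add
      (((h.aestronglyMeasurable_dvg q r T).pow 2).const_mul κ)) (Eventually.of_forall fun z => ?_)
  rw [Real.norm_of_nonneg (dissip_nonneg hκ z)]
  exact dissip_le hκ z

/-! ### Weak gradients of time slices -/

/-- Test with `ψ(x) θ(t)` and use Fubini: the defect of the identity at time `s` integrates to zero
against every `θ`, so it vanishes for almost every `s`. The exceptional null set depends on `ψ`. -/
lemma IsLeraySolution.slice_byParts (h : IsLeraySolution κ u₀ u Du) (T : ℝ) {ψ : E3 → ℝ}
    (hψ : ContDiff ℝ ∞ ψ) (hψc : HasCompactSupport ψ) (i j : Fin 3) :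
    ∀ᵐ s ∂(volume.restrict (Ioo 0 T)),
      ∫ y, u (y, s) i * pd j ψ y = - ∫ y, Du (y, s) i j * ψ y := by
  obtain ⟨r, hr⟩ := hψc.isCompact.isBounded.subset_ball (0 : E3)
  have hψ0 : ∀ x ∉ Metric.ball (0 : E3) r, ψ x = 0 := fun x hx =>
    image_eq_zero_of_notMem_tsupport fun h' => hx (hr h')
  have hpψ0 : ∀ x ∉ Metric.ball (0 : E3) r, pd j ψ x = 0 := fun x hx =>
    image_eq_zero_of_notMem_tsupport fun h' => hx (hr (tsupport_pd_subset ψ j h'))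
  have hpψ := contDiff_pd hψ j
  have hpψc := hasCompactSupport_pd hψc j
  obtain ⟨C, hC⟩ := hψc.exists_bound_of_continuous hψ.continuous
  obtain ⟨D, hD⟩ := hpψc.exists_bound_of_continuous hpψ.continuous
  set F : ℝ → ℝ := fun s => ∫ x in Metric.ball 0 r, u (x, s) i * pd j ψ x with hF
  set G : ℝ → ℝ := fun s => ∫ x in Metric.ball 0 r, Du (x, s) i j * ψ x with hG
  have hFi : IntegrableOn F (Ioo 0 T) := by
    have := integrableOn_mul_of_bounded (h.integrableOn 0 r T i)
      (g := fun z => pd j ψ z.1) (hpψ.continuous.comp continuous_fst) (fun z => hD z.1)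
    rw [IntegrableOn, volume_restrict_prod] at this
    exact this.integral_prod_right
  have hGi : IntegrableOn G (Ioo 0 T) := by
    have := integrableOn_mul_of_bounded (h.integrableOn_grad 0 r T i j)
      (g := fun z => ψ z.1) (hψ.continuous.comp continuous_fst) (fun z => hC z.1)
    rw [IntegrableOn, volume_restrict_prod] at this
    exact this.integral_prod_right
  have key : ∀ᵐ s, s ∈ Ioo 0 T → (F s + G s) = 0 := by
    refine isOpen_Ioo.ae_eq_zero_of_integral_contDiff_smul_eq_zero
      (hFi.add hGi).locallyIntegrableOn fun θ hθ hθc hθs => ?_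
    have hθ0 : ∀ t ∉ Ioo 0 T, θ t = 0 := fun t ht =>
      image_eq_zero_of_notMem_tsupport fun h' => ht (hθs h')
    have hb := h.weakGradient.byParts i j _
      (isTestFunction_mul hψ hψc hθ hθc (hθs.trans fun t ht => ht.1))
    rw [dx_mul hψ hθ] at hb
    rw [setIntegral_halfSpace_mul (h.integrableOn 0 r T i) hpψ.continuous hpψc hpψ0
        hθ.continuous hθc hθ0,
      setIntegral_halfSpace_mul (h.integrableOn_grad 0 r T i j) hψ.continuous hψc hψ0
        hθ.continuous hθc hθ0] at hb
    obtain ⟨B, hB⟩ := hθc.exists_bound_of_continuous hθ.continuous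
    have hF' : IntegrableOn (fun t => F t * θ t) (Ioo 0 T) :=
      Integrable.mul_bdd hFi hθ.continuous.aestronglyMeasurable (Eventually.of_forall hB)
    have hG' : IntegrableOn (fun t => G t * θ t) (Ioo 0 T) :=
      Integrable.mul_bdd hGi hθ.continuous.aestronglyMeasurable (Eventually.of_forall hB)
    rw [← setIntegral_eq_integral_of_forall_compl_eq_zero (s := Ioo 0 T)
      (fun t ht => by simp [hθ0 t ht])]
    calc ∫ t in Ioo 0 T, θ t • (F t + G t) = ∫ t in Ioo 0 T, (F t * θ t + G t * θ t) := by
          congr 1; funext t; rw [smul_eq_mul]; ring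
      _ = 0 := by rw [integral_add hF' hG']; linarith
  rw [ae_restrict_iff' measurableSet_Ioo]
  filter_upwards [key] with s hs hsT
  have := hs hsT
  have e1 : ∫ x in Metric.ball 0 r, u (x, s) i * pd j ψ x = ∫ x, u (x, s) i * pd j ψ x :=
    setIntegral_eq_integral_of_forall_compl_eq_zero fun x hx => by rw [hpψ0 x hx, mul_zero]
  have e2 : ∫ x in Metric.ball 0 r, Du (x, s) i j * ψ x = ∫ x, Du (x, s) i j * ψ x :=
    setIntegral_eq_integral_of_forall_compl_eq_zero fun x hx => by rw [hψ0 x hx, mul_zero]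
  rw [← e1, ← e2]
  simp only [hF, hG] at this
  linarith

lemma locallyIntegrable_of_forall_ball {f : E3 → ℝ}
    (h : ∀ n : ℕ, IntegrableOn f (Metric.ball 0 n)) : LocallyIntegrable f := by
  intro x
  obtain ⟨n, hn⟩ := exists_nat_gt (dist x 0)
  exact ⟨Metric.ball 0 n, Metric.isOpen_ball.mem_nhds hn, h n⟩

lemma ae_locallyIntegrable_slice {f : E3 × ℝ → ℝ} {T : ℝ}
    (hf : ∀ r, IntegrableOn f (Metric.ball 0 r ×ˢ Ioo 0 T)) :
    ∀ᵐ s ∂(volume.restrict (Ioo 0 T)), LocallyIntegrable fun x => f (x, s) := by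
  have : ∀ n : ℕ, ∀ᵐ s ∂(volume.restrict (Ioo 0 T)),
      IntegrableOn (fun x => f (x, s)) (Metric.ball 0 n) := fun n => by
    have := hf n
    rw [IntegrableOn, volume_restrict_prod] at this
    exact this.prod_left_ae
  filter_upwards [ae_all_iff.2 this] with s hs
  exact locallyIntegrable_of_forall_ball hs

lemma pd_convolution {ρ v : E3 → ℝ} (hρ : ContDiff ℝ 1 ρ) (hρc : HasCompactSupport ρ)
    (hv : LocallyIntegrable v) (j : Fin 3) (x : E3) :
    pd j (ρ ⋆[lsmul ℝ ℝ, volume] v) x = ∫ y, v y * pd j ρ (x - y) := by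
  have h1 := (hρc.hasFDerivAt_convolution_left (lsmul ℝ ℝ) hρ hv x).fderiv
  have hex : ConvolutionExistsAt (fderiv ℝ ρ) v x
      (ContinuousLinearMap.precompL E3 (lsmul ℝ ℝ)) volume :=
    (hρc.fderiv ℝ).convolutionExists_left _ (hρ.continuous_fderiv (by simp)) hv x
  simp only [pd]
  rw [h1, convolution_eq_swap]
  rw [ContinuousLinearMap.integral_apply hex.integrable_swap]
  congr 1; funext y
  simp [ContinuousLinearMap.precompL_apply, mul_comm]

/-- Almost every time slice of `u` has the slice of `Du` as its weak gradient. -/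
lemma IsLeraySolution.ae_isMollifiedGradient (h : IsLeraySolution κ u₀ u Du) (T : ℝ) :
    ∀ᵐ s ∂(volume.restrict (Ioo 0 T)), ∀ i,
      IsMollifiedGradient (fun x => u (x, s) i) (fun j x => Du (x, s) i j) := by
  have h1 : ∀ᵐ s ∂(volume.restrict (Ioo 0 T)), ∀ i, LocallyIntegrable fun x => u (x, s) i :=
    ae_all_iff.2 fun i => ae_locallyIntegrable_slice fun r => h.integrableOn 0 r T i
  have h2 : ∀ᵐ s ∂(volume.restrict (Ioo 0 T)), ∀ i j,
      LocallyIntegrable fun x => Du (x, s) i j :=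
    ae_all_iff.2 fun i => ae_all_iff.2 fun j =>
      ae_locallyIntegrable_slice (f := fun z => Du z i j) fun r => h.integrableOn_grad 0 r T i j
  -- Only countably many test functions are used, the mollifiers reflected and translated to a dense
  -- sequence of points, so one null set of times serves them all.
  have h3 : ∀ᵐ s ∂(volume.restrict (Ioo 0 T)), ∀ (i j : Fin 3) (n m : ℕ),
      ∫ y, u (y, s) i * pd j (fun y => (mollifier E3 n).normed volume
          (TopologicalSpace.denseSeq E3 m - y)) y
        = - ∫ y, Du (y, s) i j * (mollifier E3 n).normed volume
          (TopologicalSpace.denseSeq E3 m - y) := by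
    simp only [ae_all_iff]
    intro i j n m
    refine h.slice_byParts T ?_ ?_ i j
    · exact (mollifier E3 n).contDiff_normed.comp (contDiff_const.sub contDiff_id)
    · exact (mollifier E3 n).hasCompactSupport_normed.comp_homeomorph
        (Homeomorph.subLeft (TopologicalSpace.denseSeq E3 m))
  filter_upwards [h1, h2, h3] with s hs1 hs2 hs3 i
  refine ⟨hs1 i, hs2 i, fun n j => ?_⟩
  set ρ := (mollifier E3 n).normed (volume : Measure E3) with hρ
  have hρs : ContDiff ℝ 1 ρ := (mollifier E3 n).contDiff_normed (n := 1)
  have hρc : HasCompactSupport ρ := (mollifier E3 n).hasCompactSupport_normed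
  have hc1 : Continuous (pd j (ρ ⋆[lsmul ℝ ℝ, volume] fun x => u (x, s) i)) :=
    ((hρc.contDiff_convolution_left (n := 1) _ hρs (hs1 i)).continuous_fderiv
      (by simp)).clm_apply continuous_const
  have hc2 : Continuous (ρ ⋆[lsmul ℝ ℝ, volume] fun x => Du (x, s) i j) :=
    hρc.continuous_convolution_left _ hρs.continuous (hs2 i j)
  -- Both sides are continuous in `x`, so agreement at the dense points gives agreement everywhere.
  refine congrFun (Continuous.ext_on (TopologicalSpace.denseRange_denseSeq E3) hc1 hc2 ?_)
  rintro _ ⟨m, rfl⟩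
  rw [pd_convolution hρs hρc (hs1 i), convolution_lsmul_swap]
  have hby := hs3 i j n m
  rw [← hρ] at hby
  have hp : ∀ y, pd j (fun y => ρ (TopologicalSpace.denseSeq E3 m - y)) y
      = - pd j ρ (TopologicalSpace.denseSeq E3 m - y) := by
    intro y
    have ha : HasFDerivAt (fun y : E3 => TopologicalSpace.denseSeq E3 m - y)
        (-ContinuousLinearMap.id ℝ E3) y := (hasFDerivAt_id y).const_sub _
    have hb := ((hρs.differentiable (by simp)
      (TopologicalSpace.denseSeq E3 m - y)).hasFDerivAt).comp y ha
    simp only [pd]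
    change (fderiv ℝ (ρ ∘ _) y) _ = _
    rw [hb.fderiv]; simp
  simp only [hp, mul_neg, integral_neg, neg_inj] at hby
  rw [hby]
  simp only [smul_eq_mul, mul_comm]

/-! ### Distributional inequalities in time -/

section time

lemma indicator_one_locallyIntegrable (s t : ℝ) :
    LocallyIntegrable ((Ioc s t).indicator fun _ => (1 : ℝ)) :=
  ((integrableOn_const (C := (1 : ℝ)) (by simp)).integrable_indicator
    measurableSet_Ioc).locallyIntegrable

/-- Mollified indicator function of `(s, t]`. -/
def timeCutoff (n : ℕ) (s t : ℝ) : ℝ → ℝ :=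
  (mollifier ℝ n).normed volume ⋆[lsmul ℝ ℝ, volume] (Ioc s t).indicator fun _ => (1 : ℝ)

lemma timeCutoff_eq (n : ℕ) (s t τ : ℝ) :
    timeCutoff n s t τ = ∫ σ in Ioc s t, (mollifier ℝ n).normed volume (τ - σ) := by
  rw [timeCutoff, convolution_lsmul_swap, ← integral_indicator measurableSet_Ioc]
  congr 1; funext σ
  by_cases h : σ ∈ Ioc s t <;> simp [h]

lemma contDiff_timeCutoff (n : ℕ) (s t : ℝ) : ContDiff ℝ ∞ (timeCutoff n s t) :=
  (mollifier ℝ n).hasCompactSupport_normed.contDiff_convolution_left (n := ⊤) _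
    ((mollifier ℝ n).contDiff_normed) (indicator_one_locallyIntegrable s t)

lemma integrable_normed_sub (n : ℕ) (τ : ℝ) :
    Integrable fun σ => (mollifier ℝ n).normed volume (τ - σ) :=
  ((mollifier ℝ n).integrable_normed (μ := volume)).comp_sub_left τ

lemma timeCutoff_nonneg (n : ℕ) (s t τ : ℝ) : 0 ≤ timeCutoff n s t τ := by
  rw [timeCutoff_eq]
  exact integral_nonneg fun σ => (mollifier ℝ n).nonneg_normed _

lemma timeCutoff_le_one (n : ℕ) (s t τ : ℝ) : timeCutoff n s t τ ≤ 1 := by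
  rw [timeCutoff_eq]
  refine (setIntegral_le_integral (integrable_normed_sub n τ)
    (Eventually.of_forall fun σ => (mollifier ℝ n).nonneg_normed _)).trans_eq ?_
  rw [integral_sub_left_eq_self (fun σ => (mollifier ℝ n).normed volume σ)]
  exact (mollifier ℝ n).integral_normed

lemma tsupport_timeCutoff_subset (n : ℕ) (s t : ℝ) :
    tsupport (timeCutoff n s t) ⊆ Icc (s - (mollifier ℝ n).rOut) (t + (mollifier ℝ n).rOut) := by
  refine closure_minimal (fun τ hτ => ?_) isClosed_Icc
  obtain ⟨a, ha, b, hb, rfl⟩ := support_convolution_subset _ hτ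
  rw [(mollifier ℝ n).support_normed_eq, Metric.mem_ball, dist_zero_right, Real.norm_eq_abs,
    abs_lt] at ha
  have hb' : b ∈ Ioc s t := by
    by_contra h; simp [h] at hb
  simp only [mem_Icc]
  constructor <;> linarith [hb'.1, hb'.2]

/-- The difference of two approximate delta functions, at `s` and at `t`. Paired with `f`, it
produces mollified values of `f` at `s` and `t`; evenness of the bump puts the arguments in the form
in which they occur in a convolution. -/
lemma deriv_timeCutoff (n : ℕ) {s t : ℝ} (hst : s ≤ t) (τ : ℝ) :
    deriv (timeCutoff n s t) τ
      = (mollifier ℝ n).normed volume (s - τ) - (mollifier ℝ n).normed volume (t - τ) := by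
  set ρ := (mollifier ℝ n).normed (volume : Measure ℝ) with hρ
  have hρs : ContDiff ℝ 1 ρ := (mollifier ℝ n).contDiff_normed (n := 1)
  have h1 := ((mollifier ℝ n).hasCompactSupport_normed.hasDerivAt_convolution_left (lsmul ℝ ℝ)
    hρs (indicator_one_locallyIntegrable s t) τ).deriv
  rw [timeCutoff, h1, convolution_lsmul_swap]
  have h2 : ∫ σ, deriv ρ (τ - σ) • (Ioc s t).indicator (fun _ => (1 : ℝ)) σ
      = ∫ σ in s..t, deriv ρ (τ - σ) := by
    rw [intervalIntegral.integral_of_le hst, ← integral_indicator measurableSet_Ioc]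
    congr 1; funext σ
    by_cases h : σ ∈ Ioc s t <;> simp [h]
  rw [h2, intervalIntegral.integral_comp_sub_left (fun x => deriv ρ x),
    intervalIntegral.integral_deriv_eq_sub (fun x _ => hρs.differentiable (by simp) x)
      ((hρs.continuous_deriv (by simp)).intervalIntegrable _ _)]
  rw [hρ, ← (mollifier ℝ n).normed_neg (τ - s), ← (mollifier ℝ n).normed_neg (τ - t)]
  simp

/-- A distributional differential inequality `f' ≤ k` on `(0, T)` integrates to
`f t ≤ f s + ∫ k` at almost all pairs of times. -/
lemma exists_ae_le_add_integral {f k : ℝ → ℝ} {T : ℝ} (hf : IntegrableOn f (Ioo 0 T))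
    (hk : IntegrableOn k (Ioo 0 T))
    (H : ∀ θ : ℝ → ℝ, ContDiff ℝ ∞ θ → HasCompactSupport θ → tsupport θ ⊆ Ioo 0 T →
      (∀ t, 0 ≤ θ t) →
      0 ≤ (∫ t in Ioo 0 T, f t * deriv θ t) + ∫ t in Ioo 0 T, k t * θ t) :
    ∃ S : Set ℝ, (∀ᵐ t, t ∈ S) ∧ ∀ s ∈ S, ∀ t ∈ S, 0 < s → s < t → t < T →
      f t ≤ f s + ∫ τ in Ioc s t, k τ := by
  set F := (Ioo 0 T).indicator f with hF
  have hFi : Integrable F := hf.integrable_indicator measurableSet_Ioo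
  -- The admissible times are those at which the mollifications of `f`, extended by zero, converge
  -- to its value; almost every time is one.
  refine ⟨{x | Tendsto (fun n => ((mollifier ℝ n).normed volume ⋆[lsmul ℝ ℝ, volume] F) x) atTop
      (𝓝 (F x))}, ae_tendsto_mollifier hFi.locallyIntegrable, fun s hs t ht hs0 hst htT => ?_⟩
  have hFs : F s = f s := indicator_of_mem (s := Ioo 0 T) ⟨hs0, hst.trans htT⟩ f
  have hFt : F t = f t := indicator_of_mem (s := Ioo 0 T) ⟨hs0.trans hst, htT⟩ f
  rw [mem_ofPred_eq, hFs] at hs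
  rw [mem_ofPred_eq, hFt] at ht
  have hconv : ∀ n x, ((mollifier ℝ n).normed volume ⋆[lsmul ℝ ℝ, volume] F) x
      = ∫ τ in Ioo 0 T, f τ * (mollifier ℝ n).normed volume (x - τ) := by
    intro n x
    rw [convolution_lsmul_swap, ← integral_indicator measurableSet_Ioo]
    congr 1; funext τ
    by_cases h : τ ∈ Ioo 0 T <;> simp [hF, h, mul_comm]
  have hi : ∀ n x, IntegrableOn (fun τ => f τ * (mollifier ℝ n).normed volume (x - τ))
      (Ioo 0 T) := by
    intro n x
    obtain ⟨B, hB⟩ := ((mollifier ℝ n).hasCompactSupport_normed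
      (μ := volume)).exists_bound_of_continuous (mollifier ℝ n).continuous_normed
    exact Integrable.mul_bdd hf (((mollifier ℝ n).continuous_normed.comp
      (continuous_const.sub continuous_id)).aestronglyMeasurable)
      (Eventually.of_forall fun τ => hB _)
  have hlim : Tendsto (fun n => ∫ τ in Ioo 0 T, k τ * timeCutoff n s t τ) atTop
      (𝓝 (∫ τ in Ioc s t, k τ)) := by
    have e : ∫ τ in Ioc s t, k τ
        = ∫ τ in Ioo 0 T, k τ * (Ioc s t).indicator (fun _ => (1 : ℝ)) τ := by
      have : ∀ τ, k τ * (Ioc s t).indicator (fun _ => (1 : ℝ)) τ = (Ioc s t).indicator k τ := by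
        intro τ; by_cases h : τ ∈ Ioc s t <;> simp [h]
      simp_rw [this]
      rw [setIntegral_indicator measurableSet_Ioc]
      congr 2
      ext τ
      simp only [mem_Ioc, mem_inter_iff, mem_Ioo]
      constructor
      · rintro ⟨h1, h2⟩; exact ⟨⟨by linarith, by linarith⟩, h1, h2⟩
      · rintro ⟨-, h⟩; exact h
    rw [e]
    refine tendsto_integral_of_dominated_convergence (fun τ => ‖k τ‖) (fun n => ?_) hk.norm
      (fun n => Eventually.of_forall fun τ => ?_) ?_
    · exact hk.aestronglyMeasurable.mul
        (contDiff_timeCutoff n s t).continuous.aestronglyMeasurable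
    · rw [norm_mul, Real.norm_of_nonneg (timeCutoff_nonneg n s t τ)]
      exact mul_le_of_le_one_right (norm_nonneg _) (timeCutoff_le_one n s t τ)
    · refine ae_restrict_of_ae ?_
      filter_upwards [ae_tendsto_mollifier (indicator_one_locallyIntegrable s t)] with τ hτ
      exact hτ.const_mul (k τ)
  have hev : ∀ᶠ n in atTop, 0 ≤
      (((mollifier ℝ n).normed volume ⋆[lsmul ℝ ℝ, volume] F) s
        - ((mollifier ℝ n).normed volume ⋆[lsmul ℝ ℝ, volume] F) t)
        + ∫ τ in Ioo 0 T, k τ * timeCutoff n s t τ := by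
    -- With mollification radius below `min s (T - t)` the time cutoff is supported in `(0, T)` and
    -- is admissible in `H`.
    have hr : ∀ᶠ n in atTop, (mollifier ℝ n).rOut < min s (T - t) :=
      (tendsto_rOut_mollifier ℝ).eventually (gt_mem_nhds (lt_min hs0 (by linarith)))
    filter_upwards [hr] with n hn
    rw [lt_min_iff] at hn
    have hsub := tsupport_timeCutoff_subset n s t
    have := H (timeCutoff n s t) (contDiff_timeCutoff n s t)
      (isCompact_Icc.of_isClosed_subset (isClosed_tsupport _) hsub)
      (hsub.trans fun τ hτ => ⟨by linarith [hτ.1], by linarith [hτ.2]⟩)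
      (timeCutoff_nonneg n s t)
    simp_rw [deriv_timeCutoff n hst.le, mul_sub] at this
    rwa [integral_sub (hi n s) (hi n t), ← hconv, ← hconv] at this
  have := ge_of_tendsto ((hs.sub ht).add hlim) hev
  linarith

end time

/-! ### Interpolation and the flux on a time slice -/

/-- With `a = δ Z` and `b = K W / δ³` the hypothesis reads `X⁴ ≤ a³ b`, and `a³ b ≤ (a + b)⁴`. It
separates the dissipation, with a small coefficient, from a power of the energy. -/
lemma ennreal_young {X W Z K δ : ℝ≥0∞} (hδ : δ ≠ 0) (hδt : δ ≠ ⊤) (hK : K ≠ 0) (hKt : K ≠ ⊤)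
    (h : X ^ 4 ≤ K * W * Z ^ 3) : X ≤ δ * Z + K / δ ^ 3 * W := by
  rcases eq_or_ne Z ⊤ with rfl | hZ
  · simp [ENNReal.mul_top hδ]
  rcases eq_or_ne W ⊤ with rfl | hW
  · rw [ENNReal.mul_top (ENNReal.div_ne_zero.2 ⟨hK, ENNReal.pow_ne_top hδt⟩)]; simp
  have hX : X ≠ ⊤ := by
    rintro rfl
    have : K * W * Z ^ 3 = ⊤ := by simpa using h
    exact ENNReal.mul_ne_top (ENNReal.mul_ne_top hKt hW) (ENNReal.pow_ne_top hZ) this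
  lift X to NNReal using hX
  lift Z to NNReal using hZ
  lift W to NNReal using hW
  lift K to NNReal using hKt
  lift δ to NNReal using hδt
  have hδ' : δ ≠ 0 := by simpa using hδ
  rw [← ENNReal.coe_pow, ← ENNReal.coe_div (pow_ne_zero 3 hδ')]
  norm_cast at h ⊢
  by_contra! hlt
  have h4 : (δ * Z + K / δ ^ 3 * W) ^ 4 < X ^ 4 := pow_lt_pow_left₀ hlt (by simp) (by norm_num)
  have h5 : K * W * Z ^ 3 ≤ (δ * Z + K / δ ^ 3 * W) ^ 4 := by
    calc K * W * Z ^ 3 = (δ * Z) ^ 3 * (K / δ ^ 3 * W) := by field_simp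
      _ ≤ (δ * Z + K / δ ^ 3 * W) ^ 3 * (δ * Z + K / δ ^ 3 * W) := by
          gcongr <;> simp
      _ = _ := by ring
  exact absurd (h4.trans_le h) (not_lt.2 h5)

lemma enorm_pow_six_le (v : E3) : ‖v‖ₑ ^ 6 ≤ 9 * ∑ i, ‖v i‖ₑ ^ 6 := by
  have h : ‖v‖ ^ 6 ≤ 9 * ∑ i, ‖v i‖ ^ 6 := by
    have h1 : ‖v‖ ^ 2 = ∑ i, ‖v i‖ ^ 2 := EuclideanSpace.norm_sq_eq v
    have h2 := pow_sum_div_card_le_sum_pow (s := Finset.univ) (f := fun i => ‖v i‖ ^ 2)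
      (fun _ _ => by positivity) 2
    rw [← h1, div_le_iff₀' (by simp)] at h2
    simp only [← pow_mul] at h2
    norm_num at h2 ⊢
    exact h2
  have h3 := ENNReal.ofReal_le_ofReal h
  rw [ENNReal.ofReal_mul (by norm_num), ENNReal.ofReal_sum_of_nonneg (fun _ _ => by positivity)] at h3
  simpa only [ENNReal.ofReal_pow (norm_nonneg _), ofReal_norm, ENNReal.ofReal_ofNat] using h3

lemma enorm_apply_le (v : E3) (i : Fin 3) : ‖v i‖ₑ ≤ ‖v‖ₑ := by
  rw [← ofReal_norm, ← ofReal_norm]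
  exact ENNReal.ofReal_le_ofReal (PiLp.norm_apply_le v i)

/-- Interpolation between `L²` and `H¹` on a time slice. -/
lemma exists_cubic_bound : ∃ K : NNReal, 0 < K ∧ ∀ (q : E3) (R : ℝ), 0 < R →
    ∀ (v : E3 → E3) (g : E3 → Fin 3 → Fin 3 → ℝ),
    (∀ i, IsMollifiedGradient (fun x => v x i) (fun j x => g x i j)) →
    AEMeasurable v →
    (∫⁻ x in Metric.ball q (2 * R), ‖v x‖ₑ ^ 3) ^ 4
      ≤ K * (∫⁻ x in Metric.ball q (8 * R), ‖v x‖ₑ ^ 2) ^ 3 *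
        ((∫⁻ x in Metric.ball q (8 * R), ENNReal.ofReal (∑ i, ∑ j, g x i j ^ 2))
          + ENNReal.ofReal (1 / R ^ 2) * ∫⁻ x in Metric.ball q (8 * R), ‖v x‖ₑ ^ 2) ^ 3 := by
  obtain ⟨K, hK⟩ := exists_local_sobolev
  -- 27 = 9 · 3: the factor of `enorm_pow_six_le` times the number of components. The `+ 1` makes
  -- the constant positive, as Young's inequality requires later.
  refine ⟨27 * K + 1, by positivity, fun q R hR v g hv hvm => ?_⟩
  set Y := ∫⁻ x in Metric.ball q (8 * R), ‖v x‖ₑ ^ 2 with hY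
  set Z := ∫⁻ x in Metric.ball q (8 * R), ENNReal.ofReal (∑ i, ∑ j, g x i j ^ 2) with hZ
  set μ := (volume : Measure E3).restrict (Metric.ball q (2 * R)) with hμ
  have hm : AEMeasurable (fun x => ‖v x‖ₑ) μ := hvm.enorm.restrict
  have hsub : Metric.ball q (2 * R) ⊆ Metric.ball q (8 * R) :=
    Metric.ball_subset_ball (by linarith)
  have hYle : ∫⁻ x, ‖v x‖ₑ ^ 2 ∂μ ≤ Y := lintegral_mono_set hsub
  -- Interpolation of `L³` between `L²` and `L⁶` by two applications of Cauchy–Schwarz, splitting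
  -- the exponents as 3 = 1 + 2 and 4 = 1 + 3.
  have h3 : (∫⁻ x, ‖v x‖ₑ ^ 3 ∂μ) ^ 2 ≤ Y * ∫⁻ x, ‖v x‖ₑ ^ 4 ∂μ := by
    have := lintegral_mul_sq_le μ hm (hm.pow_const 2)
    have e : ∀ x, ‖v x‖ₑ * ‖v x‖ₑ ^ 2 = ‖v x‖ₑ ^ 3 := fun x => by ring
    simp only [e, ← pow_mul] at this
    exact this.trans (by gcongr)
  have h4 : (∫⁻ x, ‖v x‖ₑ ^ 4 ∂μ) ^ 2 ≤ Y * ∫⁻ x, ‖v x‖ₑ ^ 6 ∂μ := by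
    have := lintegral_mul_sq_le μ hm (hm.pow_const 3)
    have e : ∀ x, ‖v x‖ₑ * ‖v x‖ₑ ^ 3 = ‖v x‖ₑ ^ 4 := fun x => by ring
    simp only [e, ← pow_mul] at this
    exact this.trans (by gcongr)
  have h6 : ∫⁻ x, ‖v x‖ₑ ^ 6 ∂μ ≤ 27 * K * (Z + ENNReal.ofReal (1 / R ^ 2) * Y) ^ 3 := by
    have hmi : ∀ i, AEMeasurable (fun x => ‖v x i‖ₑ) μ := fun i =>
      ((hv i).locInt.aestronglyMeasurable.enorm).restrict
    calc ∫⁻ x, ‖v x‖ₑ ^ 6 ∂μ ≤ ∫⁻ x, 9 * ∑ i, ‖v x i‖ₑ ^ 6 ∂μ :=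
          lintegral_mono fun x => enorm_pow_six_le (v x)
      _ = 9 * ∑ i, ∫⁻ x, ‖v x i‖ₑ ^ 6 ∂μ := by
          rw [lintegral_const_mul' _ _ (by simp),
            lintegral_finsetSum' _ fun i _ => (hmi i).pow_const 6]
      _ ≤ 9 * ∑ i : Fin 3, K * (Z + ENNReal.ofReal (1 / R ^ 2) * Y) ^ 3 := by
          gcongr with i
          -- The cutoff doubles the radius and the local Sobolev inequality multiplies it by 4; this
          -- is the origin of the radius `8R`.
          have h8 : 4 * (2 * R) = 8 * R := by ring
          have := hK q (2 * R) (by positivity) _ _ (hv i)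
          rw [h8] at this
          refine this.trans ?_
          gcongr (K : ℝ≥0∞) * (?_ + ENNReal.ofReal (1 / ?_) * ?_) ^ 3
          · rw [← lintegral_finsetSum' _ fun j _ =>
              (((hv i).locInt_grad j).aestronglyMeasurable.enorm.restrict).pow_const 2]
            refine lintegral_mono fun x => ?_
            have e : ∀ j, ‖g x i j‖ₑ ^ 2 = ENNReal.ofReal (g x i j ^ 2) := fun j => by
              rw [← ofReal_norm, ← ENNReal.ofReal_pow (norm_nonneg _), Real.norm_eq_abs, sq_abs]
            simp only [e]
            rw [← ENNReal.ofReal_sum_of_nonneg fun _ _ => sq_nonneg _]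
            exact ENNReal.ofReal_le_ofReal
              (Finset.single_le_sum (f := fun i => ∑ j, g x i j ^ 2)
                (fun _ _ => Finset.sum_nonneg fun _ _ => sq_nonneg _) (Finset.mem_univ i))
          · nlinarith
          · exact lintegral_mono fun x => by gcongr; exact enorm_apply_le _ _
      _ = _ := by simp; ring
  calc (∫⁻ x, ‖v x‖ₑ ^ 3 ∂μ) ^ 4 = ((∫⁻ x, ‖v x‖ₑ ^ 3 ∂μ) ^ 2) ^ 2 := by ring
    _ ≤ (Y * ∫⁻ x, ‖v x‖ₑ ^ 4 ∂μ) ^ 2 := by gcongr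
    _ = Y ^ 2 * (∫⁻ x, ‖v x‖ₑ ^ 4 ∂μ) ^ 2 := by ring
    _ ≤ Y ^ 2 * (Y * (27 * K * (Z + ENNReal.ofReal (1 / R ^ 2) * Y) ^ 3)) := by
        gcongr; exact h4.trans (by gcongr)
    _ = 27 * K * Y ^ 3 * (Z + ENNReal.ofReal (1 / R ^ 2) * Y) ^ 3 := by ring
    _ ≤ _ := by
        push_cast
        gcongr
        exact le_self_add

/-- Only the product `κ |D| |v|` needs care: Young's inequality with weight `δ` splits it into a
small multiple of `κ D²`, absorbable by the dissipation, and `κ |v|² / R²`. -/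
lemma abs_flux_le {κ C R δ : ℝ} (hκ : 0 ≤ κ) (hC : 0 < C) (hR : 0 < R) (hδ : 0 < δ)
    (v p : E3) (D : ℝ) (hp : ∀ j, |p j| ≤ C / R) :
    |(‖v‖ ^ 2 / 2 - κ * D) * ∑ j, v j * p j|
      ≤ 3 * C / R * ‖v‖ ^ 3 + δ / 2 * (κ * D ^ 2)
        + 9 * C ^ 2 / (2 * δ) * (κ / R ^ 2) * ‖v‖ ^ 2 := by
  have hs : |∑ j, v j * p j| ≤ 3 * C / R * ‖v‖ := by
    calc |∑ j, v j * p j| ≤ ∑ j, |v j * p j| := Finset.abs_sum_le_sum_abs _ _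
      _ ≤ ∑ j : Fin 3, ‖v‖ * (C / R) := by
          refine Finset.sum_le_sum fun j _ => ?_
          rw [abs_mul]
          exact mul_le_mul (PiLp.norm_apply_le v j) (hp j) (abs_nonneg _) (norm_nonneg _)
      _ = _ := by simp; ring
  have h1 : |‖v‖ ^ 2 / 2 - κ * D| ≤ ‖v‖ ^ 2 / 2 + κ * |D| := by
    refine (abs_sub _ _).trans ?_
    rw [abs_mul, abs_of_nonneg hκ, abs_of_nonneg (by positivity)]
  set b := 3 * C / R * ‖v‖ with hb
  have hb0 : 0 ≤ b := by positivity
  have h2 : κ * |D| * b ≤ κ * (δ / 2 * D ^ 2 + b ^ 2 / (2 * δ)) := by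
    rw [mul_assoc]
    refine mul_le_mul_of_nonneg_left ?_ hκ
    have h0 : 0 ≤ (δ * |D| - b) ^ 2 / (2 * δ) := by positivity
    have e : (δ * |D| - b) ^ 2 / (2 * δ) = δ / 2 * D ^ 2 + b ^ 2 / (2 * δ) - |D| * b := by
      rw [← sq_abs D]; field_simp; ring
    linarith
  calc |(‖v‖ ^ 2 / 2 - κ * D) * ∑ j, v j * p j|
      ≤ (‖v‖ ^ 2 / 2 + κ * |D|) * b := by
        rw [abs_mul]; exact mul_le_mul h1 hs (abs_nonneg _) (by positivity)
    _ = ‖v‖ ^ 2 / 2 * b + κ * |D| * b := by ring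
    _ ≤ ‖v‖ ^ 2 * b + κ * (δ / 2 * D ^ 2 + b ^ 2 / (2 * δ)) := by
        gcongr; linarith [sq_nonneg ‖v‖]
    _ = _ := by rw [hb]; field_simp; ring

/-- Bound for the energy flux through a cutoff on a time slice. -/
lemma exists_flux_bound {C : ℝ} (hC : 0 < C) {δ : NNReal} (hδ : 0 < δ) :
    ∃ c : NNReal, ∀ (κ : ℝ), 0 ≤ κ → ∀ (q : E3) (R : ℝ), 0 < R → ∀ χ : E3 → ℝ,
    (∀ j x, |pd j χ x| ≤ C / R) → ∀ (v : E3 → E3) (g : E3 → Fin 3 → Fin 3 → ℝ),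
    (∀ i, IsMollifiedGradient (fun x => v x i) (fun j x => g x i j)) → AEMeasurable v →
    ∫⁻ x in Metric.ball q (2 * R),
        ‖(‖v x‖ ^ 2 / 2 - κ * ∑ j, g x j j) * ∑ j, v x j * pd j χ x‖ₑ
      ≤ δ * (∫⁻ x in Metric.ball q (8 * R),
            ENNReal.ofReal ((∑ i, ∑ j, g x i j ^ 2) + κ * (∑ j, g x j j) ^ 2))
        + c * (ENNReal.ofReal ((1 + κ) / R ^ 2) *
            (∫⁻ x in Metric.ball q (8 * R), ‖v x‖ₑ ^ 2)
          + ENNReal.ofReal (1 / R ^ 4) *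
            (∫⁻ x in Metric.ball q (8 * R), ‖v x‖ₑ ^ 2) ^ 3) := by
  obtain ⟨K, hK0, hK⟩ := exists_cubic_bound
  set K' : NNReal := K * ((3 * C) ^ 4).toNNReal with hK'
  have hK'0 : K' ≠ 0 := by
    have : 0 < ((3 * C) ^ 4).toNNReal := Real.toNNReal_pos.2 (by positivity)
    positivity
  -- Three contributions: the lower-order term `Y / R²` in the Sobolev bound, the `κ` term of
  -- `abs_flux_le`, and Young's inequality for the cubic term. The cubic and the `κ` term each use
  -- half of `δ`.
  refine ⟨δ / 2 + (9 * C ^ 2 / (2 * δ)).toNNReal + K' / (δ / 2) ^ 3,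
    fun κ hκ q R hR χ hχ v g hg hv => ?_⟩
  set Y := ∫⁻ x in Metric.ball q (8 * R), ‖v x‖ₑ ^ 2 with hY
  set Z := ∫⁻ x in Metric.ball q (8 * R),
            ENNReal.ofReal ((∑ i, ∑ j, g x i j ^ 2) + κ * (∑ j, g x j j) ^ 2) with hZ
  set I := ∫⁻ x in Metric.ball q (2 * R), ‖v x‖ₑ ^ 3 with hI
  have hsub : Metric.ball q (2 * R) ⊆ Metric.ball q (8 * R) :=
    Metric.ball_subset_ball (by linarith)
  have hcub : I ^ 4 ≤ K * Y ^ 3 * (Z + ENNReal.ofReal (1 / R ^ 2) * Y) ^ 3 := by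
    refine (hK q R hR v g hg hv).trans ?_
    gcongr (K : ℝ≥0∞) * Y ^ 3 * (?_ + _) ^ 3
    exact lintegral_mono fun x => ENNReal.ofReal_le_ofReal (le_add_of_nonneg_right (by positivity))
  have hX : ENNReal.ofReal (3 * C / R) * I
      ≤ ((δ / 2 : NNReal) : ℝ≥0∞) * (Z + ENNReal.ofReal (1 / R ^ 2) * Y)
        + (K' : ℝ≥0∞) / ((δ / 2 : NNReal) : ℝ≥0∞) ^ 3 * (ENNReal.ofReal (1 / R ^ 4) * Y ^ 3) := by
    refine ennreal_young (by simpa using hδ.ne') ENNReal.coe_ne_top (by simpa using hK'0) (by simp) ?_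
    rw [mul_pow, ← ENNReal.ofReal_pow (by positivity)]
    have e : (3 * C / R) ^ 4 = (3 * C) ^ 4 * (1 / R ^ 4) := by field_simp
    rw [e, ENNReal.ofReal_mul (by positivity), hK', ENNReal.coe_mul]
    calc ENNReal.ofReal ((3 * C) ^ 4) * ENNReal.ofReal (1 / R ^ 4) * I ^ 4
        ≤ ENNReal.ofReal ((3 * C) ^ 4) * ENNReal.ofReal (1 / R ^ 4) *
          (K * Y ^ 3 * (Z + ENNReal.ofReal (1 / R ^ 2) * Y) ^ 3) := by gcongr
      _ = _ := by rw [ENNReal.ofReal]; ring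
  have hm : AEMeasurable (fun x => ‖v x‖ₑ) (volume.restrict (Metric.ball q (2 * R))) :=
    hv.enorm.restrict
  have hpt : ∀ x, ‖(‖v x‖ ^ 2 / 2 - κ * ∑ j, g x j j) * ∑ j, v x j * pd j χ x‖ₑ
      ≤ ENNReal.ofReal (3 * C / R) * ‖v x‖ₑ ^ 3
        + ((δ / 2 : NNReal) : ℝ≥0∞) *
          ENNReal.ofReal ((∑ i, ∑ j, g x i j ^ 2) + κ * (∑ j, g x j j) ^ 2)
        + ENNReal.ofReal (9 * C ^ 2 / (2 * δ)) * ENNReal.ofReal (κ / R ^ 2) * ‖v x‖ₑ ^ 2 := by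
    intro x
    have h := abs_flux_le hκ hC hR (NNReal.coe_pos.2 hδ) (v x)
      (WithLp.toLp 2 fun j => pd j χ x) (∑ j, g x j j) (fun j => hχ j x)
    have hg0 : 0 ≤ ∑ i, ∑ j, g x i j ^ 2 :=
      Finset.sum_nonneg fun _ _ => Finset.sum_nonneg fun _ _ => sq_nonneg _
    have h' := h.trans (add_le_add_left (add_le_add_right (mul_le_mul_of_nonneg_left
      (le_add_of_nonneg_left hg0) (by positivity : 0 ≤ (δ : ℝ) / 2)) _) _)
    have h'' := ENNReal.ofReal_le_ofReal h'
    rw [ENNReal.ofReal_add (by positivity) (by positivity),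
      ENNReal.ofReal_add (by positivity) (by positivity),
      ENNReal.ofReal_mul (by positivity), ENNReal.ofReal_mul (by positivity),
      ENNReal.ofReal_mul (by positivity), ENNReal.ofReal_mul (by positivity),
      ENNReal.ofReal_pow (norm_nonneg _), ENNReal.ofReal_pow (norm_nonneg _), ofReal_norm] at h''
    rw [← ofReal_norm, Real.norm_eq_abs]
    refine h''.trans_eq ?_
    congr 4
    rw [← ENNReal.ofReal_coe_nnreal]; simp
  calc ∫⁻ x in Metric.ball q (2 * R),
        ‖(‖v x‖ ^ 2 / 2 - κ * ∑ j, g x j j) * ∑ j, v x j * pd j χ x‖ₑ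
      ≤ ∫⁻ x in Metric.ball q (2 * R), (ENNReal.ofReal (3 * C / R) * ‖v x‖ₑ ^ 3
        + ((δ / 2 : NNReal) : ℝ≥0∞) *
          ENNReal.ofReal ((∑ i, ∑ j, g x i j ^ 2) + κ * (∑ j, g x j j) ^ 2)
        + ENNReal.ofReal (9 * C ^ 2 / (2 * δ)) * ENNReal.ofReal (κ / R ^ 2) * ‖v x‖ₑ ^ 2) :=
        lintegral_mono hpt
    _ = ENNReal.ofReal (3 * C / R) * I
        + ((δ / 2 : NNReal) : ℝ≥0∞) * (∫⁻ x in Metric.ball q (2 * R),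
          ENNReal.ofReal ((∑ i, ∑ j, g x i j ^ 2) + κ * (∑ j, g x j j) ^ 2))
        + ENNReal.ofReal (9 * C ^ 2 / (2 * δ)) * ENNReal.ofReal (κ / R ^ 2) *
          ∫⁻ x in Metric.ball q (2 * R), ‖v x‖ₑ ^ 2 := by
        rw [lintegral_add_right' _ ((hm.pow_const 2).const_mul _),
          lintegral_add_left' ((hm.pow_const 3).const_mul _),
          lintegral_const_mul' _ _ ENNReal.ofReal_ne_top, lintegral_const_mul' _ _ ENNReal.coe_ne_top,
          lintegral_const_mul' _ _ (ENNReal.mul_ne_top (by simp) (by simp))]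
    _ ≤ (((δ / 2 : NNReal) : ℝ≥0∞) * (Z + ENNReal.ofReal (1 / R ^ 2) * Y)
        + (K' : ℝ≥0∞) / ((δ / 2 : NNReal) : ℝ≥0∞) ^ 3 * (ENNReal.ofReal (1 / R ^ 4) * Y ^ 3))
        + ((δ / 2 : NNReal) : ℝ≥0∞) * Z
        + ENNReal.ofReal (9 * C ^ 2 / (2 * δ)) * ENNReal.ofReal (κ / R ^ 2) * Y := by
        exact add_le_add (add_le_add hX (mul_le_mul' le_rfl (lintegral_mono_set hsub)))
          (mul_le_mul' le_rfl (lintegral_mono_set hsub))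
    _ = δ * Z + (((δ / 2 : NNReal) : ℝ≥0∞) * (ENNReal.ofReal (1 / R ^ 2) * Y)
        + ENNReal.ofReal (9 * C ^ 2 / (2 * δ)) * (ENNReal.ofReal (κ / R ^ 2) * Y)
        + (K' : ℝ≥0∞) / ((δ / 2 : NNReal) : ℝ≥0∞) ^ 3 * (ENNReal.ofReal (1 / R ^ 4) * Y ^ 3)) := by
        have e : (δ : ℝ≥0∞) = ((δ / 2 : NNReal) : ℝ≥0∞) + ((δ / 2 : NNReal) : ℝ≥0∞) := by
          rw [← ENNReal.coe_add, add_halves]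
        rw [e]; ring
    _ ≤ _ := by
        have e3 : (((K' / (δ / 2) ^ 3 : NNReal)) : ℝ≥0∞)
            = (K' : ℝ≥0∞) / ((δ / 2 : NNReal) : ℝ≥0∞) ^ 3 := by
          rw [ENNReal.coe_div (by positivity), ENNReal.coe_pow]
        rw [ENNReal.coe_add, ENNReal.coe_add, e3]
        set a := ((δ / 2 : NNReal) : ℝ≥0∞)
        set b := (((9 * C ^ 2 / (2 * δ)).toNNReal : NNReal) : ℝ≥0∞)
        set d := (K' : ℝ≥0∞) / a ^ 3
        have hb : ENNReal.ofReal (9 * C ^ 2 / (2 * δ)) = b := rfl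
        rw [hb]
        have l1 : ENNReal.ofReal (1 / R ^ 2) ≤ ENNReal.ofReal ((1 + κ) / R ^ 2) := by
          apply ENNReal.ofReal_le_ofReal; gcongr; linarith
        have l2 : ENNReal.ofReal (κ / R ^ 2) ≤ ENNReal.ofReal ((1 + κ) / R ^ 2) := by
          apply ENNReal.ofReal_le_ofReal; gcongr; linarith
        set U := ENNReal.ofReal ((1 + κ) / R ^ 2) * Y
        set V := ENNReal.ofReal (1 / R ^ 4) * Y ^ 3
        calc δ * Z + (a * (ENNReal.ofReal (1 / R ^ 2) * Y) + b * (ENNReal.ofReal (κ / R ^ 2) * Y)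
              + d * V)
            ≤ δ * Z + (a * U + b * U + d * V) :=
              add_le_add le_rfl (add_le_add (add_le_add
                (mul_le_mul' le_rfl (mul_le_mul' l1 le_rfl))
                (mul_le_mul' le_rfl (mul_le_mul' l2 le_rfl))) le_rfl)
          _ ≤ δ * Z + (a * U + b * U + d * V) + (d * U + a * V + b * V) := le_self_add
          _ = _ := by ring

/-! ### The local energy inequality with product test functions -/

/-- Only measurability of `f` is required, not integrability: the norm of a Bochner integral is
bounded by the lower integral of the norm in any case. This lets the cubic flux be estimated without
first proving it integrable. -/
lemma enorm_setIntegral_halfSpace_le {f : E3 × ℝ → ℝ} {θ : ℝ → ℝ} {q : E3} {r T : ℝ}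
    (hf : AEStronglyMeasurable f (volume.restrict (Metric.ball q r ×ˢ Ioo 0 T)))
    (hf0 : ∀ x ∉ Metric.ball q r, ∀ t, f (x, t) = 0)
    (hθ : Continuous θ) (hθ0 : ∀ t ∉ Ioo 0 T, θ t = 0) :
    ‖∫ z in halfSpace, f z * θ z.2‖ₑ
      ≤ ∫⁻ t in Ioo 0 T, (∫⁻ x in Metric.ball q r, ‖f (x, t)‖ₑ) * ‖θ t‖ₑ := by
  have hsub : Metric.ball q r ×ˢ Ioo 0 T ⊆ halfSpace :=
    Set.prod_mono (subset_univ _) fun t ht => ht.1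
  rw [setIntegral_eq_of_subset_of_forall_sdiff_eq_zero (s := Metric.ball q r ×ˢ Ioo 0 T)
    measurableSet_halfSpace hsub]
  · refine (enorm_integral_le_lintegral_enorm _).trans ?_
    rw [lintegral_box]
    · refine (lintegral_congr fun t => ?_).le
      simp only [enorm_mul]
      rw [lintegral_mul_const' _ _ (by simp)]
    · exact (hf.mul (hθ.comp continuous_snd).aestronglyMeasurable).enorm
  · rintro ⟨x, t⟩ ⟨-, hz⟩
    rw [mem_prod, not_and_or] at hz
    rcases hz with hz | hz
    · simp [hf0 x hz]
    · simp [hθ0 t hz]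

lemma integrableOn_halfSpace_mul {f : E3 × ℝ → ℝ} {χ : E3 → ℝ} {θ : ℝ → ℝ} {q : E3} {r T : ℝ}
    (hf : IntegrableOn f (Metric.ball q r ×ˢ Ioo 0 T))
    (hχ : Continuous χ) (hχc : HasCompactSupport χ) (hχ0 : ∀ x ∉ Metric.ball q r, χ x = 0)
    (hθ : Continuous θ) (hθc : HasCompactSupport θ) (hθ0 : ∀ t ∉ Ioo 0 T, θ t = 0) :
    IntegrableOn (fun z => f z * (χ z.1 * θ z.2)) halfSpace := by
  obtain ⟨C, hC⟩ := hχc.exists_bound_of_continuous hχ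
  obtain ⟨D, hD⟩ := hθc.exists_bound_of_continuous hθ
  have hint : IntegrableOn (fun z => f z * (χ z.1 * θ z.2)) (Metric.ball q r ×ˢ Ioo 0 T) := by
    refine integrableOn_mul_of_bounded hf (by fun_prop) (C := C * D) fun z => ?_
    rw [abs_mul]
    exact mul_le_mul (hC z.1) (hD z.2) (abs_nonneg _) ((norm_nonneg _).trans (hC z.1))
  refine hint.of_forall_sdiff_eq_zero measurableSet_halfSpace ?_
  rintro ⟨x, t⟩ ⟨-, hz⟩
  rw [mem_prod, not_and_or] at hz
  rcases hz with hz | hz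
  · simp [hχ0 x hz]
  · simp [hθ0 t hz]

/-- The local energy inequality tested with `χ(x) θ(t)`. -/
lemma IsLeraySolution.energy_distributional (h : IsLeraySolution κ u₀ u Du) (hκ : 0 ≤ κ)
    {q : E3} {r T : ℝ} {χ : E3 → ℝ} (hχ : ContDiff ℝ ∞ χ) (hχc : HasCompactSupport χ)
    (hχ0 : ∀ x, 0 ≤ χ x) (hχB : ∀ x ∉ Metric.ball q r, χ x = 0)
    (hχpB : ∀ j, ∀ x ∉ Metric.ball q r, pd j χ x = 0)
    (hχlB : ∀ x ∉ Metric.ball q r, ∑ j, pd j (pd j χ) x = 0)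
    {H : ℝ → ℝ≥0∞} (hHm : AEMeasurable H (volume.restrict (Ioo 0 T)))
    (hHt : ∫⁻ t in Ioo 0 T, H t ≠ ⊤)
    (hH : ∀ᵐ t ∂(volume.restrict (Ioo 0 T)),
      (∫⁻ x in Metric.ball q r, ‖‖u (x, t)‖ ^ 2 / 2 * ∑ j, pd j (pd j χ) x‖ₑ)
        + (∫⁻ x in Metric.ball q r,
          ‖(‖u (x, t)‖ ^ 2 / 2 - κ * dvg Du (x, t)) * ∑ j, u (x, t) j * pd j χ x‖ₑ) ≤ H t)
    {θ : ℝ → ℝ} (hθ : ContDiff ℝ ∞ θ) (hθc : HasCompactSupport θ) (hθs : tsupport θ ⊆ Ioo 0 T)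
    (hθ0 : ∀ t, 0 ≤ θ t) :
    0 ≤ (∫ t in Ioo 0 T, (∫ x in Metric.ball q r, ‖u (x, t)‖ ^ 2 / 2 * χ x) * deriv θ t)
      + ∫ t in Ioo 0 T,
        ((H t).toReal - ∫ x in Metric.ball q r, dissip κ Du (x, t) * χ x) * θ t := by
  have hθB : ∀ t ∉ Ioo 0 T, θ t = 0 := fun t ht =>
    image_eq_zero_of_notMem_tsupport fun h' => ht (hθs h')
  have hθ' : Continuous (deriv θ) := hθ.continuous_deriv (by simp)
  have hθ'c : HasCompactSupport (deriv θ) := hθc.deriv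
  have hθ'B : ∀ t ∉ Ioo 0 T, deriv θ t = 0 := fun t ht => by
    by_contra h'
    exact ht (hθs (support_deriv_subset h'))
  have hu2 : IntegrableOn (fun z => ‖u z‖ ^ 2 / 2) (Metric.ball q r ×ˢ Ioo 0 T) :=
    (h.integrableOn_sq q r T).div_const 2
  have hlap : Continuous fun x => ∑ j, pd j (pd j χ) x :=
    continuous_finsetSum _ fun j _ => (contDiff_pd (contDiff_pd hχ j) j).continuous
  have hlapc : HasCompactSupport fun x => ∑ j, pd j (pd j χ) x :=
    HasCompactSupport.intro (isCompact_closedBall q r) fun x hx =>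
      hχlB x fun h' => hx (Metric.ball_subset_closedBall h')
  have hE := h.energyIneq _
    (isTestFunction_mul hχ hχc hθ hθc (hθs.trans fun t ht => ht.1))
    (fun z => mul_nonneg (hχ0 _) (hθ0 _))
  rw [dt_mul hχ hθ, lap_mul hχ hθ] at hE
  simp_rw [dx_mul hχ hθ] at hE
  have e0 := setIntegral_halfSpace_mul (h.integrableOn_dissip hκ q r T) hχ.continuous hχc hχB
    hθ.continuous hθc hθB
  have e1 := setIntegral_halfSpace_mul hu2 hχ.continuous hχc hχB hθ' hθ'c hθ'B
  have i1 := integrableOn_halfSpace_mul hu2 hχ.continuous hχc hχB hθ' hθ'c hθ'B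
  have i2 := integrableOn_halfSpace_mul hu2 hlap hlapc hχlB hθ.continuous hθc hθB
  simp only [dissip] at e0
  rw [e0] at hE
  simp_rw [mul_add] at hE
  rw [integral_add i1 i2, e1] at hE
  have m2 : AEStronglyMeasurable (fun z : E3 × ℝ => ‖u z‖ ^ 2 / 2 * ∑ j, pd j (pd j χ) z.1)
      (volume.restrict (Metric.ball q r ×ˢ Ioo 0 T)) :=
    hu2.aestronglyMeasurable.mul (hlap.comp continuous_fst).aestronglyMeasurable
  have m3 : AEStronglyMeasurable (fun z : E3 × ℝ => (‖u z‖ ^ 2 / 2 - κ * dvg Du z) *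
      ∑ j, u z j * pd j χ z.1) (volume.restrict (Metric.ball q r ×ˢ Ioo 0 T)) := by
    refine (hu2.aestronglyMeasurable.sub ((h.aestronglyMeasurable_dvg q r T).const_mul κ)).mul ?_
    refine Finset.aestronglyMeasurable_fun_sum _ fun j _ => ?_
    exact (h.integrableOn q r T j).aestronglyMeasurable.mul
      ((contDiff_pd hχ j).continuous.comp continuous_fst).aestronglyMeasurable
  have b2 := enorm_setIntegral_halfSpace_le m2 (fun x hx t => by simp [hχlB x hx])
    hθ.continuous hθB
  have b3 := enorm_setIntegral_halfSpace_le m3 (fun x hx t => by simp [fun j => hχpB j x hx])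
    hθ.continuous hθB
  set J2 := ∫ z in halfSpace, ‖u z‖ ^ 2 / 2 * ((∑ j, pd j (pd j χ) z.1) * θ z.2) with hJ2
  set J3 := ∫ z in halfSpace, (‖u z‖ ^ 2 / 2 - κ * dvg Du z) *
    ∑ j, u z j * (pd j χ z.1 * θ z.2) with hJ3
  have e2 : ∫ z in halfSpace, (‖u z‖ ^ 2 / 2 * ∑ j, pd j (pd j χ) z.1) * θ z.2 = J2 := by
    rw [hJ2]; congr 1; funext z; ring
  have e3 : ∫ z in halfSpace, ((‖u z‖ ^ 2 / 2 - κ * dvg Du z) *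
      ∑ j, u z j * pd j χ z.1) * θ z.2 = J3 := by
    rw [hJ3]; congr 1; funext z; rw [mul_assoc, Finset.sum_mul]; simp only [mul_assoc]
  rw [e2] at b2
  rw [e3] at b3
  obtain ⟨B, hB⟩ := hθc.exists_bound_of_continuous hθ.continuous
  have hHi : IntegrableOn (fun t => (H t).toReal) (Ioo 0 T) :=
    integrable_toReal_of_lintegral_ne_top hHm hHt
  have hHθ : IntegrableOn (fun t => (H t).toReal * θ t) (Ioo 0 T) :=
    Integrable.mul_bdd hHi hθ.continuous.aestronglyMeasurable (Eventually.of_forall hB)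
  -- The comparison is made in `ℝ≥0∞`, where the slicewise majorant `H` applies directly to the
  -- absolute fluxes.
  have hsum : J2 + J3 ≤ ∫ t in Ioo 0 T, (H t).toReal * θ t := by
    have hnn : 0 ≤ ∫ t in Ioo 0 T, (H t).toReal * θ t :=
      integral_nonneg fun t => mul_nonneg ENNReal.toReal_nonneg (hθ0 t)
    rw [← ENNReal.ofReal_le_ofReal_iff hnn]
    rw [ofReal_integral_eq_lintegral_ofReal hHθ
      (Eventually.of_forall fun t => mul_nonneg ENNReal.toReal_nonneg (hθ0 t))]
    have hHfin : ∀ᵐ t ∂(volume.restrict (Ioo 0 T)), H t < ⊤ := ae_lt_top' hHm hHt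
    have m2' : AEMeasurable (fun t => (∫⁻ x in Metric.ball q r,
        ‖‖u (x, t)‖ ^ 2 / 2 * ∑ j, pd j (pd j χ) x‖ₑ) * ‖θ t‖ₑ)
        (volume.restrict (Ioo 0 T)) := by
      have m := m2.enorm
      rw [volume_restrict_prod] at m
      exact (m.lintegral_prod_left').mul hθ.continuous.enorm.measurable.aemeasurable
    calc ENNReal.ofReal (J2 + J3) ≤ ‖J2 + J3‖ₑ := by
          rw [← ofReal_norm]; exact ENNReal.ofReal_le_ofReal (le_abs_self _)
      _ ≤ ‖J2‖ₑ + ‖J3‖ₑ := enorm_add_le _ _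
      _ ≤ _ := add_le_add b2 b3
      _ = _ := (lintegral_add_left' m2' _).symm
      _ ≤ _ := by
          refine lintegral_mono_ae ?_
          filter_upwards [hH, hHfin] with t ht htf
          rw [← add_mul, ENNReal.ofReal_mul ENNReal.toReal_nonneg, ENNReal.ofReal_toReal htf.ne,
            Real.enorm_of_nonneg (hθ0 t)]
          gcongr
  have hd : IntegrableOn (fun t => (∫ x in Metric.ball q r, dissip κ Du (x, t) * χ x) * θ t)
      (Ioo 0 T) := by
    obtain ⟨C, hC⟩ := hχc.exists_bound_of_continuous hχ.continuous
    have := integrableOn_mul_of_bounded (h.integrableOn_dissip hκ q r T)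
      (g := fun z => χ z.1) (hχ.continuous.comp continuous_fst) (fun z => hC z.1)
    rw [IntegrableOn, volume_restrict_prod] at this
    exact Integrable.mul_bdd this.integral_prod_right hθ.continuous.aestronglyMeasurable
      (Eventually.of_forall hB)
  simp_rw [sub_mul]
  rw [integral_sub hHθ hd]
  simp only [dissip]
  linarith

/-! ### Initial values and the integrated local energy estimate -/

/-- Every interval `(a, b)` has positive measure, so a conull set meets it. Without this, limits `t
→ 0⁺` off null sets would carry no information. -/
instance neBot_nhdsGT_inf_ae (a : ℝ) : (𝓝[>] a ⊓ ae (volume : Measure ℝ)).NeBot := by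
  rw [inf_neBot_iff]
  intro s hs s' hs'
  obtain ⟨b, hb, hsub⟩ := (mem_nhdsGT_iff_exists_Ioo_subset).1 hs
  by_contra hne
  rw [not_nonempty_iff_eq_empty] at hne
  have h1 : Ioo a b ⊆ s'ᶜ := fun x hx hx' => by
    have : x ∈ s ∩ s' := ⟨hsub hx, hx'⟩
    simp [hne] at this
  have h2 : (volume : Measure ℝ) (Ioo a b) = 0 := measure_mono_null h1 hs'
  rw [Real.volume_Ioo, ENNReal.ofReal_eq_zero] at h2
  have : a < b := hb
  linarith

lemma aemeasurable_of_components {v : E3 → E3} (h : ∀ i, AEMeasurable fun x => v x i) :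
    AEMeasurable v := by
  have h1 : AEMeasurable fun x => (fun i => v x i : Fin 3 → ℝ) := aemeasurable_pi_iff.2 h
  exact (WithLp.measurable_toLp 2 (Fin 3 → ℝ)).comp_aemeasurable h1

lemma IsLeraySolution.aemeasurable_lintegral_sq (h : IsLeraySolution κ u₀ u Du) (q : E3)
    (r T : ℝ) : AEMeasurable (fun t => ∫⁻ x in Metric.ball q r, ‖u (x, t)‖ₑ ^ 2)
      (volume.restrict (Ioo 0 T)) := by
  have m := (h.memLp_box q r T).aestronglyMeasurable.enorm.pow_const 2
  rw [volume_restrict_prod] at m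
  exact m.lintegral_prod_left'

lemma IsLeraySolution.aemeasurable_lintegral_dissip (h : IsLeraySolution κ u₀ u Du) (hκ : 0 ≤ κ)
    (q : E3) (r T : ℝ) :
    AEMeasurable (fun t => ∫⁻ x in Metric.ball q r, ENNReal.ofReal (dissip κ Du (x, t)))
      (volume.restrict (Ioo 0 T)) := by
  have m := (h.integrableOn_dissip hκ q r T).aestronglyMeasurable.aemeasurable.ennreal_ofReal
  rw [volume_restrict_prod] at m
  exact m.lintegral_prod_left'

lemma IsLeraySolution.lintegral_dissip_lt_top (h : IsLeraySolution κ u₀ u Du) (hκ : 0 ≤ κ)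
    (q : E3) (r T : ℝ) :
    ∫⁻ t in Ioo 0 T, ∫⁻ x in Metric.ball q r, ENNReal.ofReal (dissip κ Du (x, t)) < ⊤ := by
  have hi := h.integrableOn_dissip hκ q r T
  rw [← lintegral_box hi.aestronglyMeasurable.aemeasurable.ennreal_ofReal]
  exact hi.lintegral_lt_top

/-- Uniform bound of the local energy, from the energy class. -/
lemma IsLeraySolution.exists_bound_sq (h : IsLeraySolution κ u₀ u Du) {r : ℝ} (hr : 0 < r) :
    ∃ M : ℝ≥0∞, M < ⊤ ∧ ∀ q, ∀ᵐ t ∂(volume.restrict (Ioo 0 (r ^ 2))),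
      ∫⁻ x in Metric.ball q r, ‖u (x, t)‖ₑ ^ 2 ≤ M := by
  refine ⟨_, h.energyClass r hr, fun q => ?_⟩
  have h1 := ae_le_essSup (f := fun t => ∫⁻ x in Metric.ball q r, ‖u (x, t)‖ₑ ^ 2)
    (μ := volume.restrict (Ico (0 : ℝ) (r ^ 2)))
  have h2 := ae_restrict_of_ae_restrict_of_subset (Ioo_subset_Ico_self) h1
  filter_upwards [h2] with t ht
  exact ht.trans (le_self_add.trans (le_iSup (fun x₀ : E3 =>
      (essSup (fun t => ∫⁻ x in Metric.ball x₀ r, ‖u (x, t)‖ₑ ^ 2)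
          (volume.restrict (Ico (0 : ℝ) (r ^ 2)))
        + ∫⁻ t in Ioo (0 : ℝ) (r ^ 2), ∫⁻ x in Metric.ball x₀ r,
            ENNReal.ofReal (gradSq Du (x, t)))) q))

lemma lintegral_sq_eq_eLpNorm_sq (v : E3 → E3) (μ : Measure E3) :
    ∫⁻ x, ‖v x‖ₑ ^ 2 ∂μ = eLpNorm v 2 μ ^ 2 := by
  rw [eLpNorm_eq_lintegral_rpow_enorm_toReal (by norm_num) (by norm_num), ← ENNReal.rpow_natCast,
    ← ENNReal.rpow_mul]
  simp

/-- The right-hand side density of the local energy estimate. -/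
def growth (κ R : ℝ) (Y : ℝ≥0∞) : ℝ≥0∞ :=
  ENNReal.ofReal ((1 + κ) / R ^ 2) * Y + ENNReal.ofReal (1 / R ^ 4) * Y ^ 3

lemma growth_mono (κ R : ℝ) : Monotone (growth κ R) := fun a b hab => by
  unfold growth; gcongr

lemma growth_lt_top (κ R : ℝ) {Y : ℝ≥0∞} (h : Y < ⊤) : growth κ R Y < ⊤ := by
  unfold growth
  exact ENNReal.add_lt_top.2 ⟨ENNReal.mul_lt_top (by simp) h,
    ENNReal.mul_lt_top (by simp) (ENNReal.pow_lt_top h)⟩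

lemma measurable_growth (κ R : ℝ) : Measurable (growth κ R) := by
  unfold growth; fun_prop

lemma lintegral_Ioc_eq_Ioo (f : ℝ → ℝ≥0∞) (a b : ℝ) :
    ∫⁻ t in Ioc a b, f t = ∫⁻ t in Ioo a b, f t :=
  setLIntegral_congr Ioo_ae_eq_Ioc.symm

/-- The flux majorant on almost every time slice. -/
lemma exists_ae_flux_le {C : ℝ} (hC : 0 < C) {δ : NNReal} (hδ : 0 < δ) :
    ∃ c : NNReal, ∀ (κ : ℝ), 0 ≤ κ → ∀ (u₀ : E3 → E3) (u : E3 × ℝ → E3)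
      (Du : E3 × ℝ → Fin 3 → Fin 3 → ℝ), IsLeraySolution κ u₀ u Du →
      ∀ (q : E3) (R T : ℝ), 0 < R → ∀ χ : E3 → ℝ,
      (∀ j x, |pd j χ x| ≤ C / R) → (∀ x, |∑ j, pd j (pd j χ) x| ≤ C / R ^ 2) →
      ∀ᵐ t ∂(volume.restrict (Ioo 0 T)),
      (∫⁻ x in Metric.ball q (2 * R), ‖‖u (x, t)‖ ^ 2 / 2 * ∑ j, pd j (pd j χ) x‖ₑ)
        + (∫⁻ x in Metric.ball q (2 * R),
          ‖(‖u (x, t)‖ ^ 2 / 2 - κ * dvg Du (x, t)) * ∑ j, u (x, t) j * pd j χ x‖ₑ)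
      ≤ δ * (∫⁻ x in Metric.ball q (8 * R), ENNReal.ofReal (dissip κ Du (x, t)))
        + c * growth κ R (∫⁻ x in Metric.ball q (8 * R), ‖u (x, t)‖ₑ ^ 2) := by
  obtain ⟨c, hc⟩ := exists_flux_bound hC hδ
  refine ⟨c + C.toNNReal, fun κ hκ u₀ u Du h q R T hR χ hχ1 hχ2 => ?_⟩
  filter_upwards [h.ae_isMollifiedGradient T] with t ht
  have hv : AEMeasurable fun x => u (x, t) :=
    aemeasurable_of_components fun i => (ht i).locInt.aestronglyMeasurable.aemeasurable
  have hflux := hc κ hκ q R hR χ hχ1 (fun x => u (x, t)) (fun x => Du (x, t)) ht hv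
  set Y := ∫⁻ x in Metric.ball q (8 * R), ‖u (x, t)‖ₑ ^ 2
  have hlap : ∫⁻ x in Metric.ball q (2 * R), ‖‖u (x, t)‖ ^ 2 / 2 * ∑ j, pd j (pd j χ) x‖ₑ
      ≤ C.toNNReal * growth κ R Y := by
    calc ∫⁻ x in Metric.ball q (2 * R), ‖‖u (x, t)‖ ^ 2 / 2 * ∑ j, pd j (pd j χ) x‖ₑ
        ≤ ∫⁻ x in Metric.ball q (2 * R), ENNReal.ofReal (C / R ^ 2) * ‖u (x, t)‖ₑ ^ 2 := by
          refine lintegral_mono fun x => ?_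
          simp only
          rw [← ofReal_norm, ← ofReal_norm, ← ENNReal.ofReal_pow (norm_nonneg _),
            ← ENNReal.ofReal_mul (by positivity), Real.norm_eq_abs, abs_mul,
            abs_of_nonneg (by positivity : 0 ≤ ‖u (x, t)‖ ^ 2 / 2), mul_comm]
          apply ENNReal.ofReal_le_ofReal
          exact mul_le_mul (hχ2 x) (by linarith [sq_nonneg ‖u (x, t)‖]) (by positivity)
            (by positivity)
      _ = ENNReal.ofReal (C / R ^ 2) * ∫⁻ x in Metric.ball q (2 * R), ‖u (x, t)‖ₑ ^ 2 :=
          lintegral_const_mul' _ _ (by simp)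
      _ ≤ (ENNReal.ofReal C * ENNReal.ofReal ((1 + κ) / R ^ 2)) * Y := by
          rw [← ENNReal.ofReal_mul hC.le]
          refine mul_le_mul' (ENNReal.ofReal_le_ofReal ?_)
            (lintegral_mono_set (Metric.ball_subset_ball (by linarith)))
          rw [mul_div_assoc']
          gcongr
          nlinarith
      _ ≤ _ := by
          rw [mul_assoc]
          exact mul_le_mul' le_rfl le_self_add
  calc _ ≤ C.toNNReal * growth κ R Y + (δ * (∫⁻ x in Metric.ball q (8 * R),
          ENNReal.ofReal (dissip κ Du (x, t))) + c * growth κ R Y) := add_le_add hlap hflux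
    _ = _ := by push_cast; ring

/-- Minkowski's inequality with `u(s) = u₀ + (u(s) - u₀)`: the last term tends to zero in `L²` on
the closed ball. The measurability of the slice that this needs holds for almost every `s`. -/
lemma IsLeraySolution.eventually_sq_le (h : IsLeraySolution κ u₀ u Du)
    (hu₀ : ∀ K : Set E3, IsCompact K → MemLp u₀ 2 (volume.restrict K)) (q : E3) (r : ℝ) :
    ∃ e : ℝ → ℝ≥0∞, Tendsto e (𝓝[>] 0 ⊓ ae volume)
        (𝓝 (∫⁻ x in Metric.ball q r, ‖u₀ x‖ₑ ^ 2)) ∧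
      ∀ᶠ s in 𝓝[>] 0 ⊓ ae volume, ∫⁻ x in Metric.ball q r, ‖u (x, s)‖ₑ ^ 2 ≤ e s := by
  set K := Metric.closedBall q r
  have hle : (volume : Measure E3).restrict (Metric.ball q r) ≤ volume.restrict K :=
    Measure.restrict_mono Metric.ball_subset_closedBall le_rfl
  have hini := h.initial K (isCompact_closedBall q r)
  have hm0 : AEStronglyMeasurable u₀ (volume.restrict (Metric.ball q r)) :=
    (hu₀ K (isCompact_closedBall q r)).aestronglyMeasurable.mono_measure hle
  refine ⟨fun s => (eLpNorm u₀ 2 (volume.restrict (Metric.ball q r))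
    + eLpNorm (fun x => u (x, s) - u₀ x) 2 (volume.restrict K)) ^ 2, ?_, ?_⟩
  · rw [lintegral_sq_eq_eLpNorm_sq]
    have := ((ENNReal.continuous_pow 2).tendsto _).comp
      (hini.const_add (eLpNorm u₀ 2 (volume.restrict (Metric.ball q r))))
    rw [add_zero] at this
    exact this
  · have h1 : ∀ᶠ s in 𝓝[>] (0 : ℝ) ⊓ ae volume, s ∈ Ioo (0 : ℝ) 1 :=
      Filter.Eventually.filter_mono inf_le_left (Ioo_mem_nhdsGT one_pos)
    have h2 : ∀ᶠ s in 𝓝[>] (0 : ℝ) ⊓ ae volume, s ∈ Ioo (0 : ℝ) 1 → ∀ i,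
        IsMollifiedGradient (fun x => u (x, s) i) (fun j x => Du (x, s) i j) :=
      Filter.Eventually.filter_mono inf_le_right
        ((ae_restrict_iff' measurableSet_Ioo).1 (h.ae_isMollifiedGradient 1))
    filter_upwards [h1, h2] with s hs1 hs2
    have hv : AEMeasurable fun x => u (x, s) :=
      aemeasurable_of_components fun i =>
        (hs2 hs1 i).locInt.aestronglyMeasurable.aemeasurable
    rw [lintegral_sq_eq_eLpNorm_sq]
    gcongr
    have e : (fun x => u (x, s)) = u₀ + fun x => u (x, s) - u₀ x := by funext x; simp
    calc eLpNorm (fun x => u (x, s)) 2 (volume.restrict (Metric.ball q r))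
        = eLpNorm (u₀ + fun x => u (x, s) - u₀ x) 2 (volume.restrict (Metric.ball q r)) := by
          rw [← e]
      _ ≤ eLpNorm u₀ 2 (volume.restrict (Metric.ball q r))
          + eLpNorm (fun x => u (x, s) - u₀ x) 2 (volume.restrict (Metric.ball q r)) :=
          eLpNorm_add_le hm0 (hv.aestronglyMeasurable.restrict.sub hm0) (by norm_num)
      _ ≤ _ := by gcongr

/-- The integrated local energy inequality, at almost every time. -/
lemma exists_local_energy {δ : NNReal} (hδ : 0 < δ) :
    ∃ c : NNReal, ∀ (κ : ℝ), 0 ≤ κ → ∀ (u₀ : E3 → E3),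
      (∀ K : Set E3, IsCompact K → MemLp u₀ 2 (volume.restrict K)) →
      ∀ (u : E3 × ℝ → E3) (Du : E3 × ℝ → Fin 3 → Fin 3 → ℝ), IsLeraySolution κ u₀ u Du →
      ∀ (q : E3) (R : ℝ), 0 < R → ∀ᵐ t ∂(volume.restrict (Ioo 0 (R ^ 2))),
      (∫⁻ x in Metric.ball q R, ‖u (x, t)‖ₑ ^ 2 / 2)
        + (∫⁻ s in Ioo 0 t, ∫⁻ x in Metric.ball q R, ENNReal.ofReal (dissip κ Du (x, s)))
      ≤ (∫⁻ x in Metric.ball q (8 * R), ‖u₀ x‖ₑ ^ 2)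
        + δ * (∫⁻ s in Ioo 0 t, ∫⁻ x in Metric.ball q (8 * R),
            ENNReal.ofReal (dissip κ Du (x, s)))
        + c * ∫⁻ s in Ioo 0 t,
            growth κ R (∫⁻ x in Metric.ball q (8 * R), ‖u (x, s)‖ₑ ^ 2) := by
  obtain ⟨C, hC, hcut⟩ := exists_cutoff
  obtain ⟨c, hc⟩ := exists_ae_flux_le hC hδ
  refine ⟨c, fun κ hκ u₀ hu₀ u Du h q R hR => ?_⟩
  obtain ⟨χ, hχ, hχc, hχ0, hχ1, hχB, hχB', hχp, hχl, hχpB, hχlB⟩ := hcut q R hR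
  set T := R ^ 2 with hT
  set Y : ℝ → ℝ≥0∞ := fun t => ∫⁻ x in Metric.ball q (8 * R), ‖u (x, t)‖ₑ ^ 2 with hY
  set Z : ℝ → ℝ≥0∞ := fun t =>
    ∫⁻ x in Metric.ball q (8 * R), ENNReal.ofReal (dissip κ Du (x, t)) with hZ
  set H : ℝ → ℝ≥0∞ := fun t => δ * Z t + c * growth κ R (Y t) with hH
  have hYm : AEMeasurable Y (volume.restrict (Ioo 0 T)) := h.aemeasurable_lintegral_sq q _ T
  have hZm : AEMeasurable Z (volume.restrict (Ioo 0 T)) :=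
    h.aemeasurable_lintegral_dissip hκ q _ T
  have hGm : AEMeasurable (fun t => growth κ R (Y t)) (volume.restrict (Ioo 0 T)) :=
    (measurable_growth κ R).comp_aemeasurable hYm
  have hHm : AEMeasurable H (volume.restrict (Ioo 0 T)) :=
    (hZm.const_mul _).add (hGm.const_mul _)
  -- Finiteness comes from the energy class at radius `8R`, whose time interval `(0, 64R²)` contains
  -- `(0, R²)`.
  have hHt : ∫⁻ t in Ioo 0 T, H t ≠ ⊤ := by
    obtain ⟨M, hM, hMb⟩ := h.exists_bound_sq (r := 8 * R) (by positivity)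
    have hb : ∀ᵐ t ∂(volume.restrict (Ioo 0 T)), growth κ R (Y t) ≤ growth κ R M := by
      have := ae_restrict_of_ae_restrict_of_subset
        (Ioo_subset_Ioo_right (by rw [hT]; nlinarith) : Ioo 0 T ⊆ Ioo 0 ((8 * R) ^ 2)) (hMb q)
      filter_upwards [this] with t ht using growth_mono κ R ht
    rw [hH, lintegral_add_left' (hZm.const_mul _), lintegral_const_mul' _ _ (by simp),
      lintegral_const_mul' _ _ (by simp)]
    refine (ENNReal.add_lt_top.2 ⟨ENNReal.mul_lt_top (by simp)
      (h.lintegral_dissip_lt_top hκ q _ T), ENNReal.mul_lt_top (by simp) ?_⟩).ne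
    refine (lintegral_mono_ae hb).trans_lt ?_
    rw [lintegral_const]
    exact ENNReal.mul_lt_top (growth_lt_top κ R hM) (by simp)
  have hflux := hc κ hκ u₀ u Du h q R T hR χ hχp hχl
  set a : ℝ → ℝ := fun t => ∫ x in Metric.ball q (2 * R), ‖u (x, t)‖ ^ 2 / 2 * χ x with ha
  set d : ℝ → ℝ := fun t => ∫ x in Metric.ball q (2 * R), dissip κ Du (x, t) * χ x with hd
  have hu2 : Integrable (fun z : E3 × ℝ => ‖u z‖ ^ 2 / 2 * χ z.1)
      ((volume.restrict (Metric.ball q (2 * R))).prod (volume.restrict (Ioo 0 T))) := by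
    rw [← volume_restrict_prod]
    exact integrableOn_mul_of_bounded ((h.integrableOn_sq q (2 * R) T).div_const 2)
      (hχ.continuous.comp continuous_fst) (C := 1)
      fun z => by rw [abs_of_nonneg (hχ0 _)]; exact hχ1 _
  have hdi : Integrable (fun z : E3 × ℝ => dissip κ Du z * χ z.1)
      ((volume.restrict (Metric.ball q (2 * R))).prod (volume.restrict (Ioo 0 T))) := by
    rw [← volume_restrict_prod]
    exact integrableOn_mul_of_bounded (h.integrableOn_dissip hκ q (2 * R) T)
      (hχ.continuous.comp continuous_fst) (C := 1)
      fun z => by rw [abs_of_nonneg (hχ0 _)]; exact hχ1 _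
  have hai : IntegrableOn a (Ioo 0 T) := hu2.integral_prod_right
  have hddi : IntegrableOn d (Ioo 0 T) := hdi.integral_prod_right
  have hHi : IntegrableOn (fun t => (H t).toReal) (Ioo 0 T) :=
    integrable_toReal_of_lintegral_ne_top hHm hHt
  have ha0 : ∀ t, 0 ≤ a t := fun t => integral_nonneg fun x => mul_nonneg (by positivity) (hχ0 x)
  have hd0 : ∀ t, 0 ≤ d t := fun t =>
    integral_nonneg fun x => mul_nonneg (dissip_nonneg hκ _) (hχ0 x)
  -- In the sense of distributions `a' ≤ H - d` on `(0, T)`; integrating gives the inequality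
  -- between almost all pairs of times.
  obtain ⟨S, hS, hSle⟩ := exists_ae_le_add_integral hai (hHi.sub hddi)
    (fun θ hθ hθc hθs hθ0 => h.energy_distributional hκ hχ hχc hχ0 hχB' hχpB hχlB hHm hHt hflux
      hθ hθc hθs hθ0)
  obtain ⟨e, he, hle⟩ := h.eventually_sq_le hu₀ q (2 * R)
  have hau : ∀ s, ENNReal.ofReal (a s) ≤ ∫⁻ x in Metric.ball q (2 * R), ‖u (x, s)‖ₑ ^ 2 := by
    intro s
    calc ENNReal.ofReal (a s) ≤ ‖a s‖ₑ := by
          rw [← ofReal_norm]; exact ENNReal.ofReal_le_ofReal (le_abs_self _)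
      _ ≤ ∫⁻ x in Metric.ball q (2 * R), ‖‖u (x, s)‖ ^ 2 / 2 * χ x‖ₑ :=
          enorm_integral_le_lintegral_enorm _
      _ ≤ _ := by
          refine lintegral_mono fun x => ?_
          simp only
          rw [← ofReal_norm, ← ofReal_norm, ← ENNReal.ofReal_pow (norm_nonneg _)]
          apply ENNReal.ofReal_le_ofReal
          rw [Real.norm_of_nonneg (mul_nonneg (by positivity) (hχ0 x))]
          calc ‖u (x, s)‖ ^ 2 / 2 * χ x ≤ ‖u (x, s)‖ ^ 2 / 2 * 1 := by gcongr; exact hχ1 x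
            _ ≤ _ := by linarith [sq_nonneg ‖u (x, s)‖]
  have hslice : ∀ᵐ s ∂(volume.restrict (Ioo 0 T)),
      Integrable (fun x => dissip κ Du (x, s) * χ x)
        (volume.restrict (Metric.ball q (2 * R))) := hdi.prod_left_ae
  have hHfin : ∀ᵐ t ∂(volume.restrict (Ioo 0 T)), H t < ⊤ := ae_lt_top' hHm hHt
  filter_upwards [ae_restrict_of_ae hS, ae_restrict_mem measurableSet_Ioo, hu2.prod_left_ae]
    with t htS htT htu
  have hsubt : Ioc 0 t ⊆ Ioo 0 T := fun s hs => ⟨hs.1, hs.2.trans_lt htT.2⟩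
  have hsubt' : Ioo 0 t ⊆ Ioo 0 T := fun s hs => ⟨hs.1, hs.2.trans htT.2⟩
  have key : ENNReal.ofReal (a t) + ENNReal.ofReal (∫ s in (0 : ℝ)..t, d s)
      ≤ (∫⁻ x in Metric.ball q (2 * R), ‖u₀ x‖ₑ ^ 2)
        + ENNReal.ofReal (∫ s in Ioc 0 t, (H s).toReal) := by
    have hcont : Tendsto (fun s => ∫ τ in s..t, d τ) (𝓝[>] 0 ⊓ ae volume)
        (𝓝 (∫ τ in (0 : ℝ)..t, d τ)) := by
      have hdI : IntegrableOn d (uIcc 0 t) := by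
        rw [uIcc_of_le htT.1.le]
        exact (integrableOn_Icc_iff_integrableOn_Ioc).2 (hddi.mono_set hsubt)
      have := (intervalIntegral.continuousOn_primitive_interval_left hdI) 0 left_mem_uIcc
      refine Tendsto.mono_left this (inf_le_left.trans ?_)
      rw [uIcc_of_le htT.1.le]
      refine (nhdsWithin_le_of_mem ?_)
      exact mem_of_superset (Ioo_mem_nhdsGT htT.1) Ioo_subset_Icc_self
    -- The lower time `s` tends to 0 along the times in `S`: the dissipation integral is continuous
    -- in `s`, and the energy at `s` is controlled by the initial data.
    refine le_of_tendsto_of_tendsto (tendsto_const_nhds.add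
      ((ENNReal.continuous_ofReal.tendsto _).comp hcont)) (he.add_const _) ?_
    have h1 : ∀ᶠ s in 𝓝[>] (0 : ℝ) ⊓ ae volume, s ∈ Ioo (0 : ℝ) t :=
      Filter.Eventually.filter_mono inf_le_left (Ioo_mem_nhdsGT htT.1)
    have h2 : ∀ᶠ s in 𝓝[>] (0 : ℝ) ⊓ ae volume, s ∈ S :=
      Filter.Eventually.filter_mono inf_le_right hS
    filter_upwards [h1, h2, hle] with s hs hsS hse
    have hst := hSle s hsS t htS hs.1 hs.2 htT.2
    have hsub : Ioc s t ⊆ Ioc 0 t := Ioc_subset_Ioc_left hs.1.le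
    simp only [Pi.sub_apply] at hst
    rw [integral_sub (hHi.mono_set (hsub.trans hsubt)) (hddi.mono_set (hsub.trans hsubt))] at hst
    have hmono : ∫ τ in Ioc s t, (H τ).toReal ≤ ∫ τ in Ioc 0 t, (H τ).toReal :=
      setIntegral_mono_set (hHi.mono_set hsubt)
        (Eventually.of_forall fun _ => ENNReal.toReal_nonneg) hsub.eventuallyLE
    have hd0' : 0 ≤ ∫ τ in s..t, d τ :=
      intervalIntegral.integral_nonneg hs.2.le fun τ _ => hd0 τ
    have hH0 : 0 ≤ ∫ τ in Ioc 0 t, (H τ).toReal :=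
      integral_nonneg fun _ => ENNReal.toReal_nonneg
    rw [← intervalIntegral.integral_of_le hs.2.le (f := d)] at hst
    calc ENNReal.ofReal (a t) + ENNReal.ofReal (∫ τ in s..t, d τ)
        = ENNReal.ofReal (a t + ∫ τ in s..t, d τ) := (ENNReal.ofReal_add (ha0 t) hd0').symm
      _ ≤ ENNReal.ofReal (a s + ∫ τ in Ioc 0 t, (H τ).toReal) :=
          ENNReal.ofReal_le_ofReal (by linarith)
      _ = ENNReal.ofReal (a s) + ENNReal.ofReal (∫ τ in Ioc 0 t, (H τ).toReal) :=
          ENNReal.ofReal_add (ha0 s) hH0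
      _ ≤ _ := add_le_add ((hau s).trans hse) le_rfl
  have hBsub : Metric.ball q R ⊆ Metric.ball q (2 * R) := Metric.ball_subset_ball (by linarith)
  have k1 : ∫⁻ x in Metric.ball q R, ‖u (x, t)‖ₑ ^ 2 / 2 ≤ ENNReal.ofReal (a t) := by
    rw [ha, ofReal_integral_eq_lintegral_ofReal htu
      (Eventually.of_forall fun x => mul_nonneg (by positivity) (hχ0 x))]
    refine le_trans ?_ (lintegral_mono_set hBsub)
    refine setLIntegral_mono' Metric.isOpen_ball.measurableSet fun x hx => ?_
    rw [hχB x hx, mul_one, ENNReal.ofReal_div_of_pos (by norm_num),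
      ENNReal.ofReal_pow (norm_nonneg _), ofReal_norm]
    simp
  have k2 : ∫⁻ s in Ioo 0 t, ∫⁻ x in Metric.ball q R, ENNReal.ofReal (dissip κ Du (x, s))
      ≤ ENNReal.ofReal (∫ s in (0 : ℝ)..t, d s) := by
    rw [intervalIntegral.integral_of_le htT.1.le, ofReal_integral_eq_lintegral_ofReal
      (hddi.mono_set hsubt) (Eventually.of_forall hd0), lintegral_Ioc_eq_Ioo]
    refine lintegral_mono_ae ?_
    filter_upwards [ae_restrict_of_ae_restrict_of_subset hsubt' hslice] with s hs
    rw [hd, ofReal_integral_eq_lintegral_ofReal hs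
      (Eventually.of_forall fun x => mul_nonneg (dissip_nonneg hκ _) (hχ0 x))]
    refine le_trans ?_ (lintegral_mono_set hBsub)
    refine setLIntegral_mono' Metric.isOpen_ball.measurableSet fun x hx => ?_
    rw [hχB x hx, mul_one]
  have k3 : ENNReal.ofReal (∫ s in Ioc 0 t, (H s).toReal)
      = δ * (∫⁻ s in Ioo 0 t, Z s) + c * ∫⁻ s in Ioo 0 t, growth κ R (Y s) := by
    rw [ofReal_integral_eq_lintegral_ofReal (hHi.mono_set hsubt)
      (Eventually.of_forall fun _ => ENNReal.toReal_nonneg), lintegral_Ioc_eq_Ioo]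
    rw [← lintegral_const_mul' _ _ ENNReal.coe_ne_top, ← lintegral_const_mul' _ _ ENNReal.coe_ne_top,
      ← lintegral_add_left' ((hZm.mono_measure (Measure.restrict_mono hsubt' le_rfl)).const_mul _)]
    refine lintegral_congr_ae ?_
    filter_upwards [ae_restrict_of_ae_restrict_of_subset hsubt' hHfin] with s hs
    rw [ENNReal.ofReal_toReal hs.ne]
  calc _ ≤ _ := add_le_add k1 k2
    _ ≤ _ := key
    _ ≤ _ := by
        rw [k3, ← add_assoc]
        gcongr
        linarith

/-! ### Bootstrap and uniformly local estimates -/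

/-- A nonlinear Grönwall argument: an essentially bounded `y` with
`y t ≤ c (A + ∫₀ᵗ g(y))` stays below `M` as long as `c (A + T₁ g(M)) ≤ M / 2`. -/
lemma gronwall_bootstrap {y : ℝ → ℝ≥0∞} {g : ℝ≥0∞ → ℝ≥0∞} (hg : Monotone g)
    {A c M B : ℝ≥0∞} {T T₁ : ℝ} (hT : T₁ ≤ T) (hc : c < ⊤) (hM0 : M ≠ 0) (hMt : M ≠ ⊤)
    (hy : ∀ᵐ t ∂(volume.restrict (Ioo 0 T)), y t ≤ c * (A + ∫⁻ s in Ioo 0 t, g (y s)))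
    (hB : ∀ᵐ t ∂(volume.restrict (Ioo 0 T)), y t ≤ B) (hgB : g B < ⊤)
    (hM : c * (A + ENNReal.ofReal T₁ * g M) ≤ M / 2) {t : ℝ} (ht : t ≤ T₁) :
    c * (A + ∫⁻ s in Ioo 0 t, g (y s)) ≤ M := by
  have hhalf : M / 2 + M / 2 = M := ENNReal.add_halves M
  -- On any time interval of length `η` the crude bound `B` contributes at most `M / 2`. This fixed
  -- step length replaces continuity of `y`, which is not available.
  obtain ⟨η, hη, hηle⟩ : ∃ η : ℝ, 0 < η ∧ c * (ENNReal.ofReal η * g B) ≤ M / 2 := by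
    have hcg : c * g B ≠ ⊤ := (ENNReal.mul_lt_top hc hgB).ne
    set m := (c * g B).toReal with hm
    have hm0 : 0 ≤ m := ENNReal.toReal_nonneg
    have hMr : 0 < M.toReal := ENNReal.toReal_pos hM0 hMt
    refine ⟨M.toReal / 2 / (m + 1), by positivity, ?_⟩
    rw [mul_left_comm, ← ENNReal.ofReal_toReal hcg, ← ENNReal.ofReal_mul (by positivity), ← hm]
    have e : M / 2 = ENNReal.ofReal (M.toReal / 2) := by
      rw [ENNReal.ofReal_div_of_pos (by norm_num), ENNReal.ofReal_toReal hMt]; simp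
    rw [e]
    apply ENNReal.ofReal_le_ofReal
    rw [div_mul_eq_mul_div, div_le_iff₀ (by positivity)]
    nlinarith
  have hstep : ∀ n : ℕ, ∀ t ≤ T₁, t ≤ n * η → c * (A + ∫⁻ s in Ioo 0 t, g (y s)) ≤ M := by
    intro n
    induction n with
    | zero =>
      intro t _ ht
      have : Ioo 0 t = ∅ := Ioo_eq_empty (by simpa using ht)
      rw [this]
      simp only [Measure.restrict_empty, lintegral_zero_measure, add_zero]
      calc c * A ≤ c * (A + ENNReal.ofReal T₁ * g M) := by gcongr; exact le_self_add
        _ ≤ M / 2 := hM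
        _ ≤ M := ENNReal.half_le_self
    | succ n ih =>
      intro t htT ht
      push_cast at ht
      -- On `(0, t')` the induction hypothesis gives `y ≤ M`, on the remaining piece of length at
      -- most `η` only `y ≤ B` is used; the two halves of `M` add up. Measurability of `y` is never
      -- needed, only monotonicity and subadditivity of the integral over sets.
      set t' := t - η with ht'
      have h1 := ih t' (by linarith) (by linarith)
      have hsub1 : Ioo 0 t' ⊆ Ioo 0 T := Ioo_subset_Ioo_right (by linarith)
      have hy1 : ∀ᵐ s ∂(volume.restrict (Ioo 0 t')), g (y s) ≤ g M := by
        filter_upwards [ae_restrict_of_ae_restrict_of_subset hsub1 hy,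
          ae_restrict_mem measurableSet_Ioo] with s hs hst
        refine hg (hs.trans (le_trans ?_ h1))
        gcongr
        exact hst.2.le
      have hI1 : ∫⁻ s in Ioo 0 t', g (y s) ≤ ENNReal.ofReal T₁ * g M := by
        refine (lintegral_mono_ae hy1).trans ?_
        rw [lintegral_const, Measure.restrict_apply_univ, Real.volume_Ioo, mul_comm]
        gcongr
        linarith
      set W := Ico t' t ∩ Ioo 0 t with hW
      have hsub2 : W ⊆ Ioo 0 T := fun s hs => ⟨hs.2.1, by linarith [hs.2.2]⟩
      have hI2 : ∫⁻ s in W, g (y s) ≤ ENNReal.ofReal η * g B := by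
        have hy2 : ∀ᵐ s ∂(volume.restrict W), g (y s) ≤ g B := by
          filter_upwards [ae_restrict_of_ae_restrict_of_subset hsub2 hB] with s hs using hg hs
        refine (lintegral_mono_ae hy2).trans ?_
        rw [lintegral_const, Measure.restrict_apply_univ, mul_comm]
        gcongr
        refine (measure_mono inter_subset_left).trans_eq ?_
        rw [Real.volume_Ico, ht']; congr 1; ring
      have hcover : Ioo 0 t ⊆ Ioo 0 t' ∪ W := fun s hs => by
        rcases lt_or_ge s t' with h | h
        · exact Or.inl ⟨hs.1, h⟩
        · exact Or.inr ⟨⟨h, hs.2⟩, hs⟩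
      calc c * (A + ∫⁻ s in Ioo 0 t, g (y s))
          ≤ c * (A + (ENNReal.ofReal T₁ * g M + ENNReal.ofReal η * g B)) := by
            gcongr
            exact (lintegral_mono_set hcover).trans ((lintegral_union_le _ _ _).trans
              (add_le_add hI1 hI2))
        _ = c * (A + ENNReal.ofReal T₁ * g M) + c * (ENNReal.ofReal η * g B) := by ring
        _ ≤ M / 2 + M / 2 := add_le_add hM hηle
        _ = M := hhalf
  obtain ⟨n, hn⟩ := exists_nat_gt (t / η)
  exact hstep n t ht (by rw [div_lt_iff₀ hη] at hn; exact hn.le)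

lemma growth_mul_le (κ R : ℝ) {N : ℝ≥0∞} (hN : 1 ≤ N) (Y : ℝ≥0∞) :
    growth κ R (N * Y) ≤ N ^ 3 * growth κ R Y := by
  unfold growth
  have h1 : N ≤ N ^ 3 := le_self_pow₀ hN (by norm_num)
  calc _ = N * (ENNReal.ofReal ((1 + κ) / R ^ 2) * Y)
        + N ^ 3 * (ENNReal.ofReal (1 / R ^ 4) * Y ^ 3) := by ring
    _ ≤ N ^ 3 * (ENNReal.ofReal ((1 + κ) / R ^ 2) * Y)
        + N ^ 3 * (ENNReal.ofReal (1 / R ^ 4) * Y ^ 3) := by gcongr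
    _ = _ := by ring

/-- The uniformly local energy at time `t`. -/
def ulocEnergy (u : E3 × ℝ → E3) (R t : ℝ) : ℝ≥0∞ :=
  ⨆ x₀ : E3, ∫⁻ x in Metric.ball x₀ R, ‖u (x, t)‖ₑ ^ 2

/-- The uniformly local dissipation up to time `t`. -/
def ulocDissip (κ : ℝ) (Du : E3 × ℝ → Fin 3 → Fin 3 → ℝ) (R t : ℝ) : ℝ≥0∞ :=
  ⨆ x₀ : E3, ∫⁻ s in Ioo 0 t, ∫⁻ x in Metric.ball x₀ R, ENNReal.ofReal (dissip κ Du (x, s))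

/-- With space as the outer variable, the accumulated dissipation is a ball integral of a fixed
function of `x`, so the covering and density lemmas apply to it. -/
lemma IsLeraySolution.lintegral_dissip_comm (h : IsLeraySolution κ u₀ u Du) (hκ : 0 ≤ κ)
    (q : E3) (r t : ℝ) :
    ∫⁻ s in Ioo 0 t, ∫⁻ x in Metric.ball q r, ENNReal.ofReal (dissip κ Du (x, s))
      = ∫⁻ x in Metric.ball q r, ∫⁻ s in Ioo 0 t, ENNReal.ofReal (dissip κ Du (x, s)) := by
  have hm := (h.integrableOn_dissip hκ q r t).aestronglyMeasurable.aemeasurable.ennreal_ofReal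
  rw [← lintegral_box hm]
  rw [volume_restrict_prod] at hm ⊢
  exact lintegral_prod _ hm

/-- Finiteness is what permits subtracting the dissipation from both sides in the absorption step;
it follows from `dissip_le` and the energy class. -/
lemma IsLeraySolution.ulocDissip_lt_top (h : IsLeraySolution κ u₀ u Du) (hκ : 0 ≤ κ) {R t : ℝ}
    (hR : 0 < R) (ht : t ≤ R ^ 2) : ulocDissip κ Du R t < ⊤ := by
  have hE := h.energyClass R hR
  refine lt_of_le_of_lt ?_ (ENNReal.mul_lt_top (ENNReal.ofReal_lt_top (r := 1 + 3 * κ)) hE)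
  refine iSup_le fun x₀ => ?_
  calc ∫⁻ s in Ioo 0 t, ∫⁻ x in Metric.ball x₀ R, ENNReal.ofReal (dissip κ Du (x, s))
      ≤ ∫⁻ s in Ioo 0 (R ^ 2), ∫⁻ x in Metric.ball x₀ R,
          ENNReal.ofReal (1 + 3 * κ) * ENNReal.ofReal (gradSq Du (x, s)) := by
        refine lintegral_mono' (Measure.restrict_mono (Ioo_subset_Ioo_right ht) le_rfl) fun s =>
          lintegral_mono fun x => ?_
        rw [← ENNReal.ofReal_mul (by positivity)]
        exact ENNReal.ofReal_le_ofReal (dissip_le hκ _)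
    _ = ENNReal.ofReal (1 + 3 * κ) * ∫⁻ s in Ioo 0 (R ^ 2), ∫⁻ x in Metric.ball x₀ R,
          ENNReal.ofReal (gradSq Du (x, s)) := by
        simp_rw [lintegral_const_mul' _ _ ENNReal.ofReal_ne_top]
    _ ≤ _ := by
        gcongr
        exact le_trans le_add_self (le_iSup (fun x₀ : E3 =>
          (essSup (fun t => ∫⁻ x in Metric.ball x₀ R, ‖u (x, t)‖ₑ ^ 2)
              (volume.restrict (Ico (0 : ℝ) (R ^ 2)))
            + ∫⁻ t in Ioo (0 : ℝ) (R ^ 2), ∫⁻ x in Metric.ball x₀ R,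
                ENNReal.ofReal (gradSq Du (x, t)))) x₀)

/-- Supplies the crude bound `B` of the bootstrap. The null sets for a dense sequence of centres are
united, and the remaining centres follow by lower semicontinuity. -/
lemma IsLeraySolution.exists_ulocEnergy_le (h : IsLeraySolution κ u₀ u Du) {R : ℝ} (hR : 0 < R) :
    ∃ M : ℝ≥0∞, M < ⊤ ∧ ∀ᵐ t ∂(volume.restrict (Ioo 0 (R ^ 2))), ulocEnergy u R t ≤ M := by
  obtain ⟨M, hM, hb⟩ := h.exists_bound_sq hR
  refine ⟨M, hM, ?_⟩
  filter_upwards [ae_all_iff.2 fun n => hb (TopologicalSpace.denseSeq E3 n)] with t ht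
  exact iSup_le fun x => lintegral_ball_le_of_dense (TopologicalSpace.denseRange_denseSeq E3) R
    (fun x => ‖u (x, t)‖ₑ ^ 2) M ht x

/-- The closed integral inequality for the uniformly local energy. -/
lemma exists_uloc_inequality : ∃ c : NNReal, 1 ≤ c ∧ ∀ (κ : ℝ), 0 ≤ κ → ∀ (u₀ : E3 → E3),
      (∀ K : Set E3, IsCompact K → MemLp u₀ 2 (volume.restrict K)) →
      ∀ (u : E3 × ℝ → E3) (Du : E3 × ℝ → Fin 3 → Fin 3 → ℝ), IsLeraySolution κ u₀ u Du →
      ∀ (R : ℝ), 0 < R → ∀ᵐ t ∂(volume.restrict (Ioo 0 (R ^ 2))),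
      ulocEnergy u R t ≤ c * (alpha u₀ R + ∫⁻ s in Ioo 0 t, growth κ R (ulocEnergy u R s)) ∧
      ulocDissip κ Du R t
        ≤ c * (alpha u₀ R + ∫⁻ s in Ioo 0 t, growth κ R (ulocEnergy u R s)) := by
  obtain ⟨N, hN, hcov⟩ := exists_covering
  have hN0 : (N : NNReal) ≠ 0 := by exact_mod_cast hN.ne'
  have hN1 : (1 : ℝ≥0∞) ≤ N := by exact_mod_cast hN
  -- With this `δ` the dissipation over `B(q, 8R)`, at most `N` times the uniformly local one,
  -- contributes only half of the latter.
  obtain ⟨c, hc⟩ := exists_local_energy (δ := 1 / (2 * N)) (by positivity)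
  refine ⟨4 * (N + c * N ^ 3), ?_, fun κ hκ u₀ hu₀ u Du h R hR => ?_⟩
  · have : (1 : NNReal) ≤ N := by exact_mod_cast hN
    calc (1 : NNReal) ≤ 4 * 1 := by norm_num
      _ ≤ _ := by gcongr; exact this.trans le_self_add
  have hp := TopologicalSpace.denseRange_denseSeq E3
  filter_upwards [ae_all_iff.2 fun n => hc κ hκ u₀ hu₀ u Du h (TopologicalSpace.denseSeq E3 n) R hR,
    ae_restrict_mem measurableSet_Ioo] with t ht htT
  set α := alpha u₀ R with hα
  set D := ulocDissip κ Du R t with hD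
  set J := ∫⁻ s in Ioo 0 t, growth κ R (ulocEnergy u R s) with hJ
  have hDt : D < ⊤ := h.ulocDissip_lt_top hκ hR htT.2.le
  have b1 : ∀ q, ∫⁻ x in Metric.ball q (8 * R), ‖u₀ x‖ₑ ^ 2 ≤ N * α := fun q =>
    hcov R hR _ α (fun x => le_iSup (fun x₀ : E3 => ∫⁻ x in Metric.ball x₀ R, ‖u₀ x‖ₑ ^ 2) x) q
  have b2 : ∀ q, ∫⁻ s in Ioo 0 t, ∫⁻ x in Metric.ball q (8 * R),
      ENNReal.ofReal (dissip κ Du (x, s)) ≤ N * D := fun q => by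
    rw [h.lintegral_dissip_comm hκ]
    refine hcov R hR _ D (fun x => ?_) q
    rw [← h.lintegral_dissip_comm hκ]
    exact le_iSup (fun x₀ : E3 => ∫⁻ s in Ioo 0 t, ∫⁻ x in Metric.ball x₀ R,
      ENNReal.ofReal (dissip κ Du (x, s))) x
  have b3 : ∀ q, ∫⁻ s in Ioo 0 t, growth κ R (∫⁻ x in Metric.ball q (8 * R), ‖u (x, s)‖ₑ ^ 2)
      ≤ N ^ 3 * J := fun q => by
    -- The factor is finite, so it can be moved inside although the supremum over centres is not
    -- known to be measurable in time.
    rw [hJ, ← lintegral_const_mul' _ _ (by simp)]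
    refine lintegral_mono fun s => ?_
    refine (growth_mono κ R ?_).trans (growth_mul_le κ R hN1 _)
    exact hcov R hR _ _ (fun x =>
      le_iSup (fun x₀ : E3 => ∫⁻ x in Metric.ball x₀ R, ‖u (x, s)‖ₑ ^ 2) x) q
  set X := N * α + c * (N ^ 3 * J) with hX
  have hmain : ∀ n, (∫⁻ x in Metric.ball (TopologicalSpace.denseSeq E3 n) R, ‖u (x, t)‖ₑ ^ 2 / 2)
      + (∫⁻ s in Ioo 0 t, ∫⁻ x in Metric.ball (TopologicalSpace.denseSeq E3 n) R,
          ENNReal.ofReal (dissip κ Du (x, s))) ≤ X + D / 2 := fun n => by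
    refine (ht n).trans ?_
    have e : ((1 / (2 * N) : NNReal) : ℝ≥0∞) * (N * D) = D / 2 := by
      rw [← mul_assoc, mul_comm _ D, div_eq_mul_inv]
      congr 1
      have e2 : (1 / (2 * N) : NNReal) * N = 2⁻¹ := by field_simp
      have := congrArg (fun a : NNReal => (a : ℝ≥0∞)) e2
      simpa using this
    calc _ ≤ N * α + ((1 / (2 * N) : NNReal) : ℝ≥0∞) * (N * D) + c * (N ^ 3 * J) :=
          add_le_add (add_le_add (b1 _) (mul_le_mul' le_rfl (b2 _))) (mul_le_mul' le_rfl (b3 _))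
      _ = X + D / 2 := by rw [e, hX]; ring
  have hDle : D ≤ X + D / 2 := by
    refine iSup_le fun x => ?_
    rw [h.lintegral_dissip_comm hκ]
    refine lintegral_ball_le_of_dense hp R _ _ (fun n => ?_) x
    rw [← h.lintegral_dissip_comm hκ]
    exact le_add_self.trans (hmain n)
  -- Absorption: `D ≤ X + D / 2` with `D` finite.
  have hD2 : D / 2 ≤ X := by
    have h2 : D / 2 ≠ ⊤ := (ENNReal.div_lt_top hDt.ne (by norm_num)).ne
    have : D / 2 + D / 2 ≤ X + D / 2 := by rwa [ENNReal.add_halves]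
    exact (ENNReal.add_le_add_iff_right h2).1 this
  have hX2 : X + D / 2 ≤ 2 * X := by rw [two_mul]; gcongr
  -- `4X` serves both conclusions: the energy estimate carries a factor 1/2 against the bound `2X`,
  -- and the dissipation is at most `2X`.
  have hfin : 4 * X ≤ ((4 * (N + c * N ^ 3) : NNReal) : ℝ≥0∞) * (α + J) := by
    push_cast
    calc 4 * X ≤ 4 * X + 4 * (N * J + c * N ^ 3 * α) := le_self_add
      _ = _ := by rw [hX]; ring
  constructor
  · refine le_trans ?_ hfin
    refine iSup_le fun x => lintegral_ball_le_of_dense hp R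
      (fun x => ‖u (x, t)‖ₑ ^ 2) _ (fun n => ?_) x
    have h1 := le_self_add.trans ((hmain n).trans hX2)
    simp only [div_eq_mul_inv] at h1
    rw [lintegral_mul_const' _ _ (by simp), ← div_eq_mul_inv,
      ENNReal.div_le_iff (by norm_num) (by norm_num)] at h1
    calc _ ≤ _ := h1
      _ = _ := by ring
  · refine le_trans (hDle.trans (hX2.trans ?_)) hfin
    gcongr
    norm_num

/-! ### Choice of constants -/

/-- Any real `a > 0` above `α(R)` is allowed, so that `α(R) = 0` can be reached by letting `a` tend
to 0. The room between `lam` and `lam'` turns a bound at almost every time into one for the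
dissipation up to `lam R²`. -/
lemma exists_smallness_bound : ∃ c : ℝ, 1 ≤ c ∧ ∀ (κ : ℝ), 0 ≤ κ → ∀ (u₀ : E3 → E3),
      (∀ K : Set E3, IsCompact K → MemLp u₀ 2 (volume.restrict K)) →
      ∀ (u : E3 × ℝ → E3) (Du : E3 × ℝ → Fin 3 → Fin 3 → ℝ), IsLeraySolution κ u₀ u Du →
      ∀ (R : ℝ), 0 < R → ∀ (a lam lam' : ℝ), 0 < a → alpha u₀ R ≤ ENNReal.ofReal a →
      0 < lam → lam < lam' → lam' ≤ 1 / (68 * c ^ 3) →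
      lam' * (1 + κ) ≤ 1 / (68 * c ^ 3) → lam' * a ^ 2 ≤ 1 / (68 * c ^ 3) * R ^ 2 →
      (⨆ x₀ : E3, essSup (fun t => ∫⁻ x in Metric.ball x₀ R, ‖u (x, t)‖ₑ ^ 2 / 2)
          (volume.restrict (Ioo (0 : ℝ) (lam * R ^ 2))))
        + (⨆ x₀ : E3, ∫⁻ t in Ioo (0 : ℝ) (lam * R ^ 2), ∫⁻ x in Metric.ball x₀ R,
              ENNReal.ofReal (gradSq Du (x, t) + κ * dvg Du (x, t) ^ 2))
      ≤ ENNReal.ofReal (8 * c * a) := by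
  obtain ⟨c, hc1, hc⟩ := exists_uloc_inequality
  have hcR : (1 : ℝ) ≤ c := by exact_mod_cast hc1
  refine ⟨c, hcR, fun κ hκ u₀ hu₀ u Du h R hR a lam lam' ha hα hl hll hl1 hl2 hl3 => ?_⟩
  set ν : ℝ := 1 / (68 * (c : ℝ) ^ 3) with hν
  have hc0 : (0 : ℝ) < c := by linarith
  have hν0 : 0 < ν := by positivity
  have hν1 : ν ≤ 1 := by
    rw [hν, div_le_one (by positivity)]
    have : (1 : ℝ) ≤ (c : ℝ) ^ 3 := one_le_pow₀ hcR
    linarith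
  have hνc : ν * (68 * (c : ℝ) ^ 3) = 1 := by rw [hν]; field_simp
  set T₁ := lam' * R ^ 2 with hT₁
  have hT₁0 : 0 < T₁ := by have := hl.trans hll; positivity
  have hT₁T : T₁ ≤ R ^ 2 := by rw [hT₁]; nlinarith [sq_nonneg R]
  -- If the growth term contributes at most `a`, then `c (a + a) = 2ca = M / 2`, which is the
  -- bootstrap condition.
  set M : ℝ≥0∞ := ENNReal.ofReal (4 * c * a) with hM
  have hmain := hc κ hκ u₀ hu₀ u Du h R hR
  obtain ⟨B, hB, hBb⟩ := h.exists_ulocEnergy_le hR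
  have hgM : growth κ R M
      = ENNReal.ofReal ((1 + κ) / R ^ 2 * (4 * c * a) + 1 / R ^ 4 * (4 * c * a) ^ 3) := by
    rw [growth, hM, ← ENNReal.ofReal_pow (by positivity), ← ENNReal.ofReal_mul (by positivity),
      ← ENNReal.ofReal_mul (by positivity), ← ENNReal.ofReal_add (by positivity) (by positivity)]
  -- 68 = 4 + 64: the linear part of `growth` at `4ca` carries the factor 4, the cubic part 4³.
  have hsmall : T₁ * ((1 + κ) / R ^ 2 * (4 * c * a) + 1 / R ^ 4 * (4 * c * a) ^ 3) ≤ a := by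
    have e : T₁ * ((1 + κ) / R ^ 2 * (4 * c * a) + 1 / R ^ 4 * (4 * c * a) ^ 3)
        = (lam' * (1 + κ)) * (4 * c * a) + (lam' * a ^ 2) / R ^ 2 * (64 * c ^ 3 * a) := by
      rw [hT₁]; field_simp; ring
    rw [e]
    have h1 : lam' * a ^ 2 / R ^ 2 ≤ ν := by rwa [div_le_iff₀ (by positivity)]
    have hc3 : (c : ℝ) ≤ (c : ℝ) ^ 3 := le_self_pow₀ hcR (by norm_num)
    calc (lam' * (1 + κ)) * (4 * c * a) + (lam' * a ^ 2) / R ^ 2 * (64 * c ^ 3 * a)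
        ≤ ν * (4 * c ^ 3 * a) + ν * (64 * c ^ 3 * a) := by gcongr
      _ = (ν * (68 * (c : ℝ) ^ 3)) * a := by ring
      _ = a := by rw [hνc, one_mul]
  have hy : ∀ᵐ t ∂(volume.restrict (Ioo 0 (R ^ 2))), ulocEnergy u R t
      ≤ c * (ENNReal.ofReal a + ∫⁻ s in Ioo 0 t, growth κ R (ulocEnergy u R s)) := by
    filter_upwards [hmain] with t ht
    exact ht.1.trans (by gcongr)
  have hMcond : (c : ℝ≥0∞) * (ENNReal.ofReal a + ENNReal.ofReal T₁ * growth κ R M) ≤ M / 2 := by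
    rw [hgM, ← ENNReal.ofReal_mul hT₁0.le, ← ENNReal.ofReal_add ha.le (by positivity),
      ← ENNReal.ofReal_coe_nnreal, ← ENNReal.ofReal_mul hc0.le]
    have e : M / 2 = ENNReal.ofReal (2 * c * a) := by
      rw [hM, show (4 : ℝ) * c * a = (2 * c * a) * 2 by ring, ENNReal.ofReal_mul (by positivity)]
      simp only [ENNReal.ofReal_ofNat]
      exact ENNReal.mul_div_cancel_right (by norm_num) (by norm_num)
    rw [e]
    apply ENNReal.ofReal_le_ofReal
    nlinarith
  have hF : ∀ t ≤ T₁, (c : ℝ≥0∞) * (ENNReal.ofReal a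
      + ∫⁻ s in Ioo 0 t, growth κ R (ulocEnergy u R s)) ≤ M := fun t ht =>
    gronwall_bootstrap (growth_mono κ R) hT₁T ENNReal.coe_lt_top
      (ENNReal.ofReal_pos.2 (by positivity)).ne' ENNReal.ofReal_ne_top hy hBb
      (growth_lt_top κ R hB) hMcond ht
  have hmain' : ∀ᵐ t ∂(volume.restrict (Ioo 0 T₁)), ulocEnergy u R t ≤ M ∧
      ulocDissip κ Du R t ≤ M := by
    filter_upwards [ae_restrict_of_ae_restrict_of_subset (Ioo_subset_Ioo_right hT₁T) hmain,
      ae_restrict_mem measurableSet_Ioo] with t ht htT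
    have hb : (c : ℝ≥0∞) * (alpha u₀ R + ∫⁻ s in Ioo 0 t, growth κ R (ulocEnergy u R s)) ≤ M :=
      le_trans (by gcongr) (hF t htT.2.le)
    exact ⟨ht.1.trans hb, ht.2.trans hb⟩
  have hlT : lam * R ^ 2 < T₁ := by rw [hT₁]; gcongr
  have p1 : (⨆ x₀ : E3, essSup (fun t => ∫⁻ x in Metric.ball x₀ R, ‖u (x, t)‖ₑ ^ 2 / 2)
          (volume.restrict (Ioo (0 : ℝ) (lam * R ^ 2)))) ≤ M := by
    refine iSup_le fun x₀ => essSup_le_of_ae_le _ ?_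
    filter_upwards [ae_restrict_of_ae_restrict_of_subset (Ioo_subset_Ioo_right hlT.le) hmain']
      with t ht
    refine le_trans ?_ ht.1
    refine le_trans (lintegral_mono fun x => ENNReal.half_le_self) ?_
    exact le_iSup (fun x₀ : E3 => ∫⁻ x in Metric.ball x₀ R, ‖u (x, t)‖ₑ ^ 2) x₀
  have p2 : (⨆ x₀ : E3, ∫⁻ t in Ioo (0 : ℝ) (lam * R ^ 2), ∫⁻ x in Metric.ball x₀ R,
              ENNReal.ofReal (gradSq Du (x, t) + κ * dvg Du (x, t) ^ 2)) ≤ M := by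
    have hl0 : 0 < lam * R ^ 2 := by positivity
    -- The interval between `lam R²` and `T₁` has positive measure, hence contains a good time; the
    -- dissipation is monotone in time.
    have hres : ∀ᵐ t ∂(volume.restrict (Ioo (lam * R ^ 2) T₁)), ulocDissip κ Du R t ≤ M ∧
        t ∈ Ioo (lam * R ^ 2) T₁ := by
      filter_upwards [ae_restrict_of_ae_restrict_of_subset (Ioo_subset_Ioo_left hl0.le) hmain',
        ae_restrict_mem measurableSet_Ioo] with t ht ht' using ⟨ht.2, ht'⟩
    have : (ae (volume.restrict (Ioo (lam * R ^ 2) T₁))).NeBot := by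
      rw [ae_neBot, Ne, Measure.restrict_eq_zero, Real.volume_Ioo, ENNReal.ofReal_eq_zero]
      linarith
    obtain ⟨t, ht, htI⟩ := hres.exists
    refine le_trans (iSup_mono fun x₀ => ?_) ht
    exact lintegral_mono_set (Ioo_subset_Ioo_right htI.1.le)
  calc _ ≤ M + M := add_le_add p1 p2
    _ = _ := by
        rw [hM, ← ENNReal.ofReal_add (by positivity) (by positivity)]; congr 1; ring

end ToyModel

end

theorem lemma3p1 :
    ∃ μ : ℝ, 0 < μ ∧ ∃ C₀ : ℝ, 0 < C₀ ∧
      ∀ (κ : ℝ), 0 ≤ κ →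
      ∀ (u₀ : ToyModel.E3 → ToyModel.E3),
        (∀ K : Set ToyModel.E3, IsCompact K → MemLp u₀ 2 (volume.restrict K)) →
      ∀ (R : ℝ), 0 < R → ToyModel.alpha u₀ R < ⊤ →
      ∀ (u : ToyModel.E3 × ℝ → ToyModel.E3) (Du : ToyModel.E3 × ℝ → Fin 3 → Fin 3 → ℝ),
        ToyModel.IsLeraySolution κ u₀ u Du →
      ∀ (lam : ℝ), 0 < lam →
        -- inverses in `ℝ≥0∞`: if `α(R) = 0`, then `α(R)⁻² R² = ∞`
        ENNReal.ofReal lam < ENNReal.ofReal μ *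
          min 1 (min ((ToyModel.alpha u₀ R ^ 2)⁻¹ * ENNReal.ofReal (R ^ 2))
            (ENNReal.ofReal ((1 + κ)⁻¹))) →
        (⨆ x₀ : ToyModel.E3,
            essSup (fun t => ∫⁻ x in Metric.ball x₀ R, ‖u (x, t)‖ₑ ^ 2 / 2)
              (volume.restrict (Ioo (0 : ℝ) (lam * R ^ 2))))
          + (⨆ x₀ : ToyModel.E3,
              ∫⁻ t in Ioo (0 : ℝ) (lam * R ^ 2), ∫⁻ x in Metric.ball x₀ R,
                ENNReal.ofReal (ToyModel.gradSq Du (x, t) + κ * ToyModel.dvg Du (x, t) ^ 2))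
        ≤ ENNReal.ofReal C₀ * ToyModel.alpha u₀ R := by
  obtain ⟨c, hc, hmain⟩ := ToyModel.exists_smallness_bound
  have hc0 : 0 < c := by linarith
  set ν : ℝ := 1 / (68 * c ^ 3) with hν
  have hν0 : 0 < ν := by positivity
  refine ⟨ν, hν0, 8 * c, by positivity, fun κ hκ u₀ hu₀ R hR hα u Du h lam hl hlt => ?_⟩
  have hlt' : ∀ x : ℝ, min 1 (min ((ToyModel.alpha u₀ R ^ 2)⁻¹ * ENNReal.ofReal (R ^ 2))
      (ENNReal.ofReal ((1 + κ)⁻¹))) ≤ ENNReal.ofReal x → lam < ν * x := by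
    intro x hx
    have h1 := hlt.trans_le (mul_le_mul' (le_refl (ENNReal.ofReal ν)) hx)
    rw [← ENNReal.ofReal_mul hν0.le] at h1
    exact (ENNReal.ofReal_lt_ofReal_iff_of_nonneg hl.le).1 h1
  have l1 : lam < ν * 1 := hlt' 1 (by rw [ENNReal.ofReal_one]; exact min_le_left _ _)
  have l2 : lam < ν * (1 + κ)⁻¹ := hlt' _ ((min_le_right _ _).trans (min_le_right _ _))
  have hκ1 : 0 < 1 + κ := by linarith
  rcases eq_or_ne (ToyModel.alpha u₀ R) 0 with h0 | h0
  · rw [h0, mul_zero]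
    refine ENNReal.le_of_forall_pos_le_add fun ε hε _ => ?_
    rw [zero_add]
    -- The first bound turns `8ca` into at most `ε`; the second gives `a² ≤ R²`, so the condition
    -- involving `a` follows from `lam' ≤ ν`.
    set a : ℝ := min (ε / (8 * c)) R with ha
    have ha0 : 0 < a := lt_min (by positivity) hR
    set lam' := min (ν * 1) (ν * (1 + κ)⁻¹) with hlam'
    have hl'0 : 0 < lam' := lt_min (by positivity) (by positivity)
    have hl'1 : lam' ≤ ν := (min_le_left _ _).trans_eq (mul_one ν)
    refine (hmain κ hκ u₀ hu₀ u Du h R hR a lam lam' ha0 (by rw [h0]; simp) hl (lt_min l1 l2)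
      hl'1 ?_ ?_).trans ?_
    · calc lam' * (1 + κ) ≤ ν * (1 + κ)⁻¹ * (1 + κ) := by gcongr; exact min_le_right _ _
        _ = ν := by field_simp
    · have : a ≤ R := min_le_right _ _
      gcongr
    · rw [← ENNReal.ofReal_coe_nnreal]
      apply ENNReal.ofReal_le_ofReal
      calc 8 * c * a ≤ 8 * c * (ε / (8 * c)) := by gcongr; exact min_le_left _ _
        _ = ε := by field_simp
  · set a := (ToyModel.alpha u₀ R).toReal with ha
    have ha0 : 0 < a := ENNReal.toReal_pos h0 hα.ne
    have hαa : ToyModel.alpha u₀ R = ENNReal.ofReal a := (ENNReal.ofReal_toReal hα.ne).symm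
    have l3 : lam < ν * ((a ^ 2)⁻¹ * R ^ 2) := by
      refine hlt' _ ((min_le_right _ _).trans ((min_le_left _ _).trans_eq ?_))
      rw [hαa, ← ENNReal.ofReal_pow ha0.le, ← ENNReal.ofReal_inv_of_pos (by positivity),
        ← ENNReal.ofReal_mul (by positivity)]
    -- The largest value allowed by the three smallness conditions; it exceeds `lam` because the
    -- hypothesis on `lam` is strict.
    set lam' := min (ν * 1) (min (ν * (1 + κ)⁻¹) (ν * ((a ^ 2)⁻¹ * R ^ 2))) with hlam'
    have hl'1 : lam' ≤ ν := (min_le_left _ _).trans_eq (mul_one ν)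
    rw [hαa, ← ENNReal.ofReal_mul (by positivity)]
    refine hmain κ hκ u₀ hu₀ u Du h R hR a lam lam' ha0 hαa.le hl (lt_min l1 (lt_min l2 l3))
      hl'1 ?_ ?_
    · calc lam' * (1 + κ) ≤ ν * (1 + κ)⁻¹ * (1 + κ) := by
            gcongr; exact (min_le_right _ _).trans (min_le_left _ _)
        _ = ν := by field_simp
    · calc lam' * a ^ 2 ≤ ν * ((a ^ 2)⁻¹ * R ^ 2) * a ^ 2 := by
            gcongr; exact (min_le_right _ _).trans (min_le_right _ _)
        _ = ν * R ^ 2 := by field_simp
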